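/- **Setting.** Bits are added over $\mathbb F_2$. A circuit is built from AND, XOR and majority gates. A gate of type $g\in\{\mathrm{and},\mathrm{xor},\mathrm{maj}\}$ operated at supply energy $E_v>0$ outputs the flipped value with probability $\epsilon_g(E_v)$, independently over all gate activations. Each $\epsilon_g\ge 0$ is strictly decreasing on $(0,\infty)$, and $\epsilon_g^{-1}$ denotes its inverse, defined on its range. All gates are operated at the same $E_v$, and one activation costs energy $E_v$. The task is to compute $\mathbf r=\mathbf s\mathbf A$ for a binary $L\times K$ matrix $\mathbf A$, $L\ge 2$, $K\ge 1$. The bit error probability is $P_e^{\rm bit}=\frac1K\sum_{k=1}^K\Pr(\hat r_k\ne r_k)$, averaged over uniform inputs $\mathbf s$ and the noise. The energy per output bit is the total energy of all gate activations divided by $K$. *Uncoded scheme.* Every output bit is a dot product, computed by $L$ AND gates followed by a chain of $L-1$ two-input XOR gates. *Code.* A binary regular LDPC code of length $N$ and dimension $K$, with a systematic generator matrix $\mathbf G=[\mathbf I,\mathbf P]$, variable node degree $d_v\ge4$ and check node degree $d_c\ge d_v$. Put $\tilde{\mathbf G}=\mathbf A\mathbf G$, with rows $\tilde{\mathbf g}_1,\dots,\tilde{\mathbf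 g}_L$ (precomputed without noise). *ENCODED-T.* Take a $d_T$-branch tree ($d_T\ge2$) with $L$ leaves and $\lceil\frac{L-1}{d_T-1}\rceil$ non-leaf nodes, filled level by level. Leaf $l$ computes $d_v$ copies of the word $s_l\tilde{\mathbf g}_l$ with $d_vN$ AND gates, one for each edge of the Tanner graph. Each non-leaf node, for every edge, XORs the bits of its children on that edge, and then performs one Gallager-B iteration: on each edge, an XOR gate forms the check-to-variable message from the bits on the other $d_c-1$ edges at the check node, and then a majority gate forms the variable-to-check message from the messages on the other $d_v-1$ edges at the variable node (ties are broken by a fair random bit). One of the $d_v$ copies at the root is selected uniformly at random, and its first $K$ bits are the output. *Threshold.* Let $d=\lceil\frac{d_v-1}2\rceil$ and $$p_{\rm thr}=\binom{d_v-1}{\lfloor (d_v-1)/2\rfloor}^{-\frac1{d-1}}d_c^{-\frac d{d-1}}d_T^{-\frac1{d-1}}(d_T+1)^{-\frac d{d-1}} .$$ **Proposition 1.** Let $D>3$ be a bound on the fan-in of the gates, so that $d_v,d_c,d_T\le D$. There are constants $c,C>0$ depending only on $D$ such that the following holds for all such tradeoff functions, all $L,K,\mathbf A$, all $p_{\rm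 tar}>0$ and all such codes and trees, whenever the inverses that occur are defined. 1. (Uncoded.) If $\max\{\epsilon_{\rm and}(E_v),\epsilon_{\rm xor}(E_v)\}<\frac1{2L-2}$ and the uncoded scheme operated at $E_v$ has $P_e^{\rm bit}<p_{\rm tar}$, then its energy per output bit is at least $$c\,L\,\max\{\epsilon_{\rm and}^{-1}(2p_{\rm tar}/L),\ \epsilon_{\rm xor}^{-1}(2p_{\rm tar}/L)\}.$$ 2. (ENCODED-T, upper bound.) Suppose that every cycle of the Tanner graph is longer than $\frac{2\log N}{\log((d_v-1)(d_c-1))}-2c_g$, where $c_g=1-\log\frac{d_cd_v-d_c-d_v}{2d_c}\big/\log((d_v-1)(d_c-1))$, that $$\Big\lceil\frac{\log L}{\log d_T}\Big\rceil\le\frac{\log N}{2\log((d_v-1)(d_c-1))},$$ and that $\frac12p_{\rm tar}\le\min\{1,\frac{d_T+1}{d_c}\}\,p_{\rm thr}$. Then there is a supply energy $E_v>0$ with $\epsilon_g(E_v)<\frac12$ for all $g$ at which ENCODED-T has $P_e^{\rm bit}<p_{\rm tar}$ and energy per output bit at most $$C\,\frac{LN}K\max\{\epsilon_{\rm maj}^{-1}(\tfrac12p_{\rm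 tar}),\ \epsilon_{\rm xor}^{-1}(\tfrac12p_{\rm tar}),\ \epsilon_{\rm and}^{-1}(\tfrac12p_{\rm tar})\}.$$ 3. (ENCODED-T, lower bound.) If $\epsilon_g(E_v)<\frac12$ for all $g$ and ENCODED-T operated at $E_v$ has $P_e^{\rm bit}<p_{\rm tar}$, then its energy per output bit is at least $c\,\frac{LN}K\,\epsilon_{\rm maj}^{-1}(p_{\rm tar})$. -/

import Mathlib

namespace NoisyComputing

/-! Noisy circuits built from transiently failing AND, XOR and majority gates. Bits are elements
of `ZMod 2`. -/

/-- The three kinds of unreliable gates. -/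
inductive GateKind
  | and
  | xor
  | maj

/-- A wire carries a circuit input `s l`, a stored (noise-free, precomputed) bit, or the output
of a gate. -/
inductive Wire (L : ℕ) (Gate : Type)
  | input (l : Fin L)
  | const (b : ZMod 2)
  | gate (g : Gate)

/-- The noise-free function of a gate. A majority gate outputs the bit held by more than half of
its inputs; if there is no such bit it outputs the random bit `coin`. -/
def gateFn (k : GateKind) (coin : ZMod 2) (u : Multiset (ZMod 2)) : ZMod 2 :=
  match k with
  | .and => u.prod
  | .xor => u.sum
  | .maj =>
    if u.card < 2 * u.count 1 then 1
    else if u.card < 2 * u.count 0 then 0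
    else coin

/-- A noisy computing scheme with `L` input bits and `K` output bits. The elements of `Gate` are
the activations of unreliable gates (one element for each unreliable operation). Every activation
reads inputs, stored bits and results of earlier activations. The `k`-th output bit is read from
the wire `out a k`, where `a` is drawn uniformly from the finite type `Sel` (a one-point type if
no random selection takes place). -/
structure NoisyCircuit (L K : ℕ) where
  Gate : Type
  [fintypeGate : Fintype Gate]
  [decEqGate : DecidableEq Gate]
  kind : Gate → GateKind
  ins : Gate → Multiset (Wire L Gate)
  time : Gate → ℕ
  feasible : ∀ g g', Wire.gate g' ∈ ins g → time g' < time g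
  Sel : Type
  [fintypeSel : Fintype Sel]
  out : Sel → Fin K → Wire L Gate

attribute [instance] NoisyCircuit.fintypeGate NoisyCircuit.decEqGate NoisyCircuit.fintypeSel

namespace NoisyCircuit

variable {L K : ℕ}

/-- The bit on a wire, given the inputs and the gate outputs. -/
def wireVal {Gate : Type} (s : Fin L → ZMod 2) (f : Gate → ZMod 2) : Wire L Gate → ZMod 2
  | .input l => s l
  | .const b => b
  | .gate g => f g

/-- The output `g(u₁, …, u_d) ⊕ z_g` of the gate activation `g`, for the input `s`, the failure
pattern `z` and the tie-breaking bits `coin`. -/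
def eval (C : NoisyCircuit L K) (s : Fin L → ZMod 2) (z coin : C.Gate → ZMod 2)
    (g : C.Gate) : ZMod 2 :=
  gateFn (C.kind g) (coin g)
    ((C.ins g).attach.map fun w =>
      match h : w.1 with
      | .input l => s l
      | .const b => b
      | .gate g' => eval C s z coin g') + z g
termination_by C.time g
decreasing_by exact C.feasible g g' (h ▸ w.2)

theorem eval_eq (C : NoisyCircuit L K) (s : Fin L → ZMod 2) (z coin : C.Gate → ZMod 2)
    (g : C.Gate) :
    C.eval s z coin g =
      gateFn (C.kind g) (coin g) ((C.ins g).map (wireVal s (C.eval s z coin))) + z g := by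
  rw [eval]
  congr 2
  conv_rhs => rw [← Multiset.attach_map_val (C.ins g), Multiset.map_map]
  refine Multiset.map_congr rfl fun w _ => ?_
  rcases w with ⟨w, hw⟩
  cases w <;> rfl

/-- An elementary outcome: the input vector, the failure pattern, the tie-breaking bits and the
selection of the output. -/
abbrev Outcome (C : NoisyCircuit L K) : Type :=
  (Fin L → ZMod 2) × (C.Gate → ZMod 2) × (C.Gate → ZMod 2) × C.Sel

/-- Probability of an outcome: inputs, tie-breaking bits and selection are uniform, gate `g` fails
with probability `p (kind g)`, and everything is independent. -/
noncomputable def mass (C : NoisyCircuit L K) (p : GateKind → ℝ) (ω : C.Outcome) : ℝ :=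
  (1 / 2) ^ L * (∏ g, if ω.2.1 g = 1 then p (C.kind g) else 1 - p (C.kind g)) *
    (1 / 2) ^ Fintype.card C.Gate * (1 / (Fintype.card C.Sel : ℝ))

/-- Probability of an event. -/
noncomputable def prob (C : NoisyCircuit L K) (p : GateKind → ℝ) (S : Set C.Outcome) : ℝ := by
  classical exact ∑ ω, if ω ∈ S then C.mass p ω else 0

/-- The computed output bit `r̂ k`. -/
def output (C : NoisyCircuit L K) (ω : C.Outcome) (k : Fin K) : ZMod 2 :=
  wireVal ω.1 (C.eval ω.1 ω.2.1 ω.2.2.1) (C.out ω.2.2.2 k)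

/-- The bit error probability `(1/K) ∑ₖ Pr(r̂ k ≠ r k)` for the target `r = s · A`. -/
noncomputable def bitErrorProb (C : NoisyCircuit L K) (A : Matrix (Fin L) (Fin K) (ZMod 2))
    (p : GateKind → ℝ) : ℝ :=
  (∑ k, C.prob p {ω | C.output ω k ≠ Matrix.vecMul ω.1 A k}) / K

/-- Energy per output bit if every gate activation consumes the supply energy `Ev`. -/
noncomputable def energyPerBit (C : NoisyCircuit L K) (Ev : ℝ) : ℝ :=
  (Fintype.card C.Gate : ℝ) * Ev / K

end NoisyCircuit

/-! Energy-reliability tradeoff. -/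

/-- A tradeoff function maps each supply energy `E > 0` to a failure probability and is strictly
decreasing. It need not be below `1/2` (or below `1`) at low energies, where the gate is not
operated. -/
structure IsTradeoff (ε : ℝ → ℝ) : Prop where
  nonneg : ∀ E, 0 < E → 0 ≤ ε E
  anti : StrictAntiOn ε (Set.Ioi 0)

/-- The inverse `ε⁻¹` on the range of the tradeoff function. -/
noncomputable def energyInv (ε : ℝ → ℝ) (p : ℝ) : ℝ :=
  Function.invFunOn ε (Set.Ioi 0) p

/-- A supply energy at which all three kinds of gates have failure probability below `1/2`. -/
def Operating (ε : GateKind → ℝ → ℝ) (Ev : ℝ) : Prop :=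
  0 < Ev ∧ ∀ k, ε k Ev < 1 / 2

/-! Uncoded multiplication: each output bit is a dot product, computed by `L` AND gates followed by
a chain of `L - 1` two-input XOR gates. -/

/-- Gates of the uncoded scheme: for every output bit, `L` AND gates and `L - 1` XOR gates. -/
abbrev UGate (L K : ℕ) : Type := Fin K × (Fin L ⊕ Fin (L - 1))

/-- The uncoded scheme for `r = s · A`. -/
def uncoded {L K : ℕ} (hL : 2 ≤ L) (A : Matrix (Fin L) (Fin K) (ZMod 2)) : NoisyCircuit L K where
  Gate := UGate L K
  kind
    | (_, .inl _) => .and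
    | (_, .inr _) => .xor
  ins
    | (k, .inl l) => {.input l, .const (A l k)}
    | (k, .inr j) =>
      {(if j.1 = 0 then .gate (k, .inl ⟨0, by omega⟩)
        else .gate (k, .inr ⟨j.1 - 1, by omega⟩)),
       .gate (k, .inl ⟨j.1 + 1, by omega⟩)}
  time
    | (_, .inl _) => 0
    | (_, .inr j) => j.1 + 1
  feasible := by
    rintro ⟨k, l | j⟩ g' h
    · simp at h
    · by_cases hj : j.1 = 0
      · simp only [hj, if_true, Multiset.insert_eq_cons, Multiset.mem_cons, Wire.gate.injEq,
          Multiset.mem_singleton] at h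
        rcases h with rfl | rfl <;> simp
      · simp only [hj, if_false, Multiset.insert_eq_cons, Multiset.mem_cons, Wire.gate.injEq,
          Multiset.mem_singleton] at h
        rcases h with rfl | rfl
        · simp only; omega
        · simp
  Sel := Unit
  out := fun _ k => .gate (k, .inr ⟨L - 2, by omega⟩)

/-! Regular LDPC codes. -/

/-- An edge of the Tanner graph: `(v, a)` is the `a`-th edge at the variable node `v`. -/
abbrev Edge (N dv : ℕ) : Type := Fin N × Fin dv

/-- A binary `(dv, dc)`-regular LDPC code of length `N` and dimension `K`, with its Tanner graph and
a systematic generator matrix `G = [I, P]`. -/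
structure LDPCCode (N K dv dc : ℕ) where
  /-- the number of parity check nodes -/
  numChecks : ℕ
  /-- the parity check node at the other end of an edge -/
  chk : Edge N dv → Fin numChecks
  /-- the edges at a variable node lead to different parity check nodes -/
  chk_inj : ∀ v, Function.Injective fun a => chk (v, a)
  /-- every parity check node has degree `dc` -/
  chk_deg : ∀ c, (Finset.univ.filter fun e => chk e = c).card = dc
  G : Matrix (Fin K) (Fin N) (ZMod 2)
  dim_le : K ≤ N
  systematic : ∀ k k' : Fin K, G k (Fin.castLE dim_le k') = if k = k' then 1 else 0
  /-- the words satisfying all parity checks are the words generated by `G` -/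
  code : ∀ x : Fin N → ZMod 2,
    (∀ c, ∑ e ∈ Finset.univ.filter (fun e => chk e = c), x e.1 = 0) ↔
      ∃ r : Fin K → ZMod 2, x = Matrix.vecMul r G

/-- The Tanner graph. -/
def LDPCCode.tanner {N K dv dc : ℕ} (𝒞 : LDPCCode N K dv dc) :
    SimpleGraph (Fin N ⊕ Fin 𝒞.numChecks) :=
  SimpleGraph.fromRel fun x y => ∃ e, x = .inl e.1 ∧ y = .inr (𝒞.chk e)

/-- The constant `c_g` in the girth bound. -/
noncomputable def girthConst (dv dc : ℕ) : ℝ :=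
  1 - Real.log (((dc : ℝ) * dv - dc - dv) / (2 * dc)) / Real.log (((dv : ℝ) - 1) * ((dc : ℝ) - 1))

/-- Large girth: every cycle of the Tanner graph is longer than
`2 log N / log ((dv - 1) (dc - 1)) - 2 c_g`. -/
def LDPCCode.LargeGirth {N K dv dc : ℕ} (𝒞 : LDPCCode N K dv dc) : Prop :=
  ∀ (x : Fin N ⊕ Fin 𝒞.numChecks) (w : 𝒞.tanner.Walk x x), w.IsCycle →
    2 * Real.log N / Real.log (((dv : ℝ) - 1) * ((dc : ℝ) - 1)) - 2 * girthConst dv dc < w.length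

/-! ENCODED-T. The tree has `S = ⌈(L - 1)/(dT - 1)⌉` non-leaf nodes, at positions `0, …, S - 1`, and
`L` leaves, at positions `S, …, S + L - 1`; position `0` is the root, the levels are listed one
after the other, and the children of the node at position `i` are the nodes at the positions
`dT * i + 1, …, dT * i + dT` that exist. So all levels except possibly the last are complete,
and every non-leaf node except possibly one has exactly `dT` children. -/

/-- The number of non-leaf nodes. -/
def numInner (L dT : ℕ) : ℕ := (L - 1) ⌈/⌉ (dT - 1)

theorem numInner_pos {L dT : ℕ} (hL : 2 ≤ L) (hT : 2 ≤ dT) : 0 < numInner L dT := by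
  unfold numInner
  rw [Nat.ceilDiv_eq_add_pred_div]
  exact Nat.div_pos (by omega) (by omega)

/-- The tree nodes: non-leaf nodes and leaves. -/
abbrev TNode (L dT : ℕ) : Type := Fin (numInner L dT) ⊕ Fin L

/-- The position of a node. -/
def TNode.pos {L dT : ℕ} : TNode L dT → ℕ
  | .inl i => i.1
  | .inr l => numInner L dT + l.1

/-- The children of a non-leaf node. -/
def children {L dT : ℕ} (i : Fin (numInner L dT)) : Finset (TNode L dT) :=
  Finset.univ.filter fun ν => dT * i.1 < TNode.pos ν ∧ TNode.pos ν ≤ dT * i.1 + dT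

/-- The operations at a non-leaf node, performed for every edge of the Tanner graph: XOR of the
words of the children, check-to-variable message, variable-to-check message. -/
inductive Step
  | merge
  | check
  | vote
  deriving DecidableEq

instance : Fintype Step := ⟨{.merge, .check, .vote}, fun x => by cases x <;> simp⟩

/-- Gates of ENCODED-T: at the leaf `l` one AND gate for each edge, at every non-leaf node three
gates for each edge. -/
abbrev TGate (L N dv dT : ℕ) : Type :=
  (Fin L × Edge N dv) ⊕ (Fin (numInner L dT) × Step × Edge N dv)

/-- The gate whose output is the final result of a tree node on an edge. -/
def nodeGate {L N dv dT : ℕ} (ν : TNode L dT) (e : Edge N dv) : TGate L N dv dT :=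
  match ν with
  | .inl i => .inr (i, .vote, e)
  | .inr l => .inl (l, e)

/-- ENCODED-T for `r = s · A`. The leaf `l` computes `dv` copies of `s l · g̃ l`, where `g̃ l` is the
`l`-th row of `A * G`. A non-leaf node XORs the copies with the same index received from its
children and then performs one iteration of Gallager-B decoding. At the root, one of the `dv` copies
of the codeword is selected at random, and its systematic part is the output. -/
def encodedT {L K N dv dc dT : ℕ} (hL : 2 ≤ L) (hT : 2 ≤ dT) (𝒞 : LDPCCode N K dv dc)
    (A : Matrix (Fin L) (Fin K) (ZMod 2)) : NoisyCircuit L K where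
  Gate := TGate L N dv dT
  kind
    | .inl _ => .and
    | .inr (_, .merge, _) => .xor
    | .inr (_, .check, _) => .xor
    | .inr (_, .vote, _) => .maj
  ins
    | .inl (l, e) => {.input l, .const ((A * 𝒞.G) l e.1)}
    | .inr (i, .merge, e) => (children i).val.map fun ν => .gate (nodeGate ν e)
    | .inr (i, .check, e) =>
      (Finset.univ.filter fun e' => 𝒞.chk e' = 𝒞.chk e ∧ e' ≠ e).val.map
        fun e' => .gate (.inr (i, .merge, e'))
    | .inr (i, .vote, e) =>
      (Finset.univ.filter fun a => a ≠ e.2).val.map fun a => .gate (.inr (i, .check, (e.1, a)))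
  time
    | .inl _ => 0
    | .inr (i, .merge, _) => 3 * (numInner L dT - i.1) + 1
    | .inr (i, .check, _) => 3 * (numInner L dT - i.1) + 2
    | .inr (i, .vote, _) => 3 * (numInner L dT - i.1) + 3
  feasible := by
    rintro (⟨l, e⟩ | ⟨i, _ | _ | _, e⟩) g' h
    · simp at h
    · simp only [Multiset.mem_map, Finset.mem_val, Wire.gate.injEq] at h
      obtain ⟨ν, hν, rfl⟩ := h
      simp only [children, Finset.mem_filter, Finset.mem_univ, true_and] at hν
      rcases ν with j | l
      · have h1 : i.1 < j.1 := by
          have h2 : dT * i.1 < j.1 := hν.1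
          nlinarith
        have := j.2
        simp only [nodeGate]
        omega
      · simp [nodeGate]
    · simp only [Multiset.mem_map, Finset.mem_val, Wire.gate.injEq] at h
      obtain ⟨e', _, rfl⟩ := h
      simp
    · simp only [Multiset.mem_map, Finset.mem_val, Wire.gate.injEq] at h
      obtain ⟨a, _, rfl⟩ := h
      simp
  Sel := Fin dv
  out := fun a k =>
    .gate (.inr (⟨0, numInner_pos hL hT⟩, .vote, (Fin.castLE 𝒞.dim_le k, a)))

/-- The threshold `p_thr`, with `d = ⌈(dv - 1)/2⌉`. -/
noncomputable def pThr (dv dc dT : ℕ) : ℝ :=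
  let d : ℝ := (((dv - 1) ⌈/⌉ 2 : ℕ) : ℝ)
  (((dv - 1).choose ((dv - 1) / 2) : ℕ) : ℝ) ^ (-1 / (d - 1)) * (dc : ℝ) ^ (-d / (d - 1)) *
    (dT : ℝ) ^ (-1 / (d - 1)) * ((dT : ℝ) + 1) ^ (-d / (d - 1))

/-- The conditions on the gate failure probabilities under which ENCODED-T suppresses errors. -/
def BelowThreshold (dv dc dT : ℕ) (p : GateKind → ℝ) : Prop :=
  p .maj ≤ pThr dv dc dT ∧
  p .xor ≤ ((dT : ℝ) + 1) / dc * pThr dv dc dT ∧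
  p .and ≤ ((dT : ℝ) + 1) / dT * pThr dv dc dT

end NoisyComputing

open NoisyComputing

/-!
All three parts compare the supply energy with an inverse of a tradeoff function. As the tradeoff
functions are decreasing, this amounts to comparing gate failure probabilities with error
probabilities, for a fixed input, fixed tie-breaking bits and a fixed selection, so that only the
independent gate failures remain random (`NoisyCircuit.bitErrorProb_le`,
`NoisyCircuit.le_bitErrorProb`).

*Uncoded scheme.* All gates are linear in the failures, so an output bit is wrong exactly when an
odd number of its `2 L - 1` gates fail, which has probability
`(1 - (1 - 2 a) ^ L * (1 - 2 x) ^ (L - 1)) / 2` for failure probabilities `a` and `x`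
(`uncoded_error_prob`). Below `1 / (2 L - 2)`, convexity bounds this from below by
`L / 2 * max a x` (`uncoded_gate_bound`).

*ENCODED-T, lower bound.* The failure of the last majority gate is independent of its input, so the
output is wrong at least as often as this gate fails (`NoisyCircuit.le_pr_eval_ne`).

*ENCODED-T, upper bound.* The supply energy is chosen so that all gates fail with probability at
most `p₀ = ptar / 2`. By induction from the leaves, every tree node has error probability at most
`(1 + 1 / dT) * p₀ < ptar` on each edge (`pr_errorEvent_nodeGate_le`). Errors at XOR gates are
estimated by the union bound, which needs no independence. A vote is wrong only if its gate fails or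
some `d = ⌈(dv - 1) / 2⌉` of its messages are all wrong, and the definition of the threshold makes
the union bound over these `d`-sets at most `p₀ / dT` (`majority_union_bound`), provided that the
`dv - 1` messages are independent. They are, because they depend on disjoint sets of gates: a common
gate would yield two message paths that leave a variable node along different edges and meet again,
hence a closed walk without backtracking, hence a cycle of length at most `4 M - 2`, where `M` is the
height of the tree (`LDPCCode.MessagePath.exists_isCycle`). As `girthConst` is at most `1`, the
girth condition excludes this. Only edges have to be distinct, not variable nodes, which is why cycles
of length `4 M` do no harm.
-/

namespace NoisyComputing

/-! ### Independent Bernoulli bits -/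

section Bernoulli

variable {ι : Type} [Fintype ι]

theorem weight_nonneg {q : ι → ℝ} (h0 : ∀ i, 0 ≤ q i) (h1 : ∀ i, q i ≤ 1) (z : ι → ZMod 2) :
    0 ≤ ∏ i, if z i = 1 then q i else 1 - q i :=
  Finset.prod_nonneg fun i _ => by split_ifs <;> [exact h0 i; linarith [h1 i]]

variable [DecidableEq ι]

/-- The expectation of `f z`, where the bits `z i` are independent and `z i = 1` has probability
`q i`. -/
noncomputable def expect (q : ι → ℝ) (f : (ι → ZMod 2) → ℝ) : ℝ :=
  ∑ z, (∏ i, if z i = 1 then q i else 1 - q i) * f z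

/-- The probability of `z ∈ E`, where the bits `z i` are independent and `z i = 1` has probability
`q i`. -/
noncomputable def pr (q : ι → ℝ) (E : Set (ι → ZMod 2)) : ℝ :=
  expect q (E.indicator 1)

theorem sum_zmod_two (f : ZMod 2 → ℝ) : ∑ b, f b = f 1 + f 0 := by
  have : ∑ b, f b = f 0 + f 1 := Fin.sum_univ_two f
  rw [this, add_comm]

theorem expect_prod (q : ι → ℝ) (f : ι → ZMod 2 → ℝ) :
    expect q (fun z => ∏ i, f i (z i)) = ∏ i, (q i * f i 1 + (1 - q i) * f i 0) := by
  have h : ∀ i, q i * f i 1 + (1 - q i) * f i 0 =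
      ∑ b : ZMod 2, (if b = 1 then q i else 1 - q i) * f i b := fun i => by
    rw [sum_zmod_two]; simp
  simp_rw [h, Finset.prod_univ_sum, Fintype.piFinset_univ, expect, ← Finset.prod_mul_distrib]

theorem expect_one (q : ι → ℝ) : expect q (fun _ => 1) = 1 := by
  simpa using expect_prod q (fun _ _ => 1)

theorem expect_const_mul (q : ι → ℝ) (c : ℝ) (f : (ι → ZMod 2) → ℝ) :
    expect q (fun z => c * f z) = c * expect q f := by
  simp only [expect, Finset.mul_sum]
  exact Finset.sum_congr rfl fun z _ => by ring

theorem expect_add (q : ι → ℝ) (f h : (ι → ZMod 2) → ℝ) :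
    expect q (fun z => f z + h z) = expect q f + expect q h := by
  simp only [expect, ← Finset.sum_add_distrib, mul_add]

theorem expect_sum {κ : Type*} (q : ι → ℝ) (T : Finset κ) (f : κ → (ι → ZMod 2) → ℝ) :
    expect q (fun z => ∑ k ∈ T, f k z) = ∑ k ∈ T, expect q (f k) := by
  simp only [expect, Finset.mul_sum]
  exact Finset.sum_comm

theorem expect_mono {q : ι → ℝ} (h0 : ∀ i, 0 ≤ q i) (h1 : ∀ i, q i ≤ 1)
    {f h : (ι → ZMod 2) → ℝ} (hfh : ∀ z, f z ≤ h z) : expect q f ≤ expect q h :=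
  Finset.sum_le_sum fun z _ => mul_le_mul_of_nonneg_left (hfh z) (weight_nonneg h0 h1 z)

theorem pr_nonneg {q : ι → ℝ} (h0 : ∀ i, 0 ≤ q i) (h1 : ∀ i, q i ≤ 1)
    (E : Set (ι → ZMod 2)) : 0 ≤ pr q E :=
  Finset.sum_nonneg fun z _ => mul_nonneg (weight_nonneg h0 h1 z)
    (Set.indicator_nonneg (fun _ _ => zero_le_one) z)

theorem pr_mono {q : ι → ℝ} (h0 : ∀ i, 0 ≤ q i) (h1 : ∀ i, q i ≤ 1)
    {E F : Set (ι → ZMod 2)} (h : E ⊆ F) : pr q E ≤ pr q F :=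
  expect_mono h0 h1 fun z => Set.indicator_le_indicator_of_subset h (fun _ => zero_le_one) z

theorem pr_union_le {q : ι → ℝ} (h0 : ∀ i, 0 ≤ q i) (h1 : ∀ i, q i ≤ 1)
    (E F : Set (ι → ZMod 2)) : pr q (E ∪ F) ≤ pr q E + pr q F := by
  rw [pr, pr, pr, ← expect_add]
  refine expect_mono h0 h1 fun z => ?_
  by_cases hE : z ∈ E <;> by_cases hF : z ∈ F <;> simp [hE, hF]

theorem pr_biUnion_le {κ : Type*} {q : ι → ℝ} (h0 : ∀ i, 0 ≤ q i) (h1 : ∀ i, q i ≤ 1)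
    (T : Finset κ) (E : κ → Set (ι → ZMod 2)) :
    pr q (⋃ k ∈ T, E k) ≤ ∑ k ∈ T, pr q (E k) := by
  simp only [pr, ← expect_sum]
  refine expect_mono h0 h1 fun z => ?_
  by_cases hz : z ∈ ⋃ k ∈ T, E k
  · simp only [Set.mem_iUnion, exists_prop] at hz
    obtain ⟨k, hk, hzk⟩ := hz
    refine (Set.indicator_le' (f := (1 : (ι → ZMod 2) → ℝ)) (g := 1) (fun _ _ => le_rfl)
      (fun _ _ => zero_le_one) z).trans ?_
    refine le_trans ?_ (Finset.single_le_sum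
      (fun k _ => Set.indicator_nonneg (fun _ _ => zero_le_one) z) hk)
    simp [hzk]
  · rw [Set.indicator_of_notMem hz]
    exact Finset.sum_nonneg fun k _ => Set.indicator_nonneg (fun _ _ => zero_le_one) z

theorem pr_apply_eq_one (q : ι → ℝ) (j : ι) : pr q {z | z j = 1} = q j := by
  have h : ({z | z j = 1} : Set (ι → ZMod 2)).indicator (1 : (ι → ZMod 2) → ℝ) =
      fun z => ∏ i, if i = j then (if z i = 1 then (1 : ℝ) else 0) else 1 := by
    funext z
    simp [Set.indicator_apply]
  rw [pr, h, expect_prod q (fun i b => if i = j then (if b = 1 then (1 : ℝ) else 0) else 1)]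
  rw [Finset.prod_eq_single j]
  · simp
  · intro i _ hi
    simp [hi]
  · simp

/-- Functions of disjoint sets of independent bits are uncorrelated. -/
theorem expect_mul {q : ι → ℝ} {f h : (ι → ZMod 2) → ℝ} {S : Set ι}
    (hf : DependsOn f S) (hh : DependsOn h Sᶜ) :
    expect q (fun z => f z * h z) = expect q f * expect q h := by
  classical
  let e := Equiv.piEquivPiSubtypeProd (fun i => i ∈ S) (fun _ : ι => ZMod 2)
  let w : ι → ZMod 2 → ℝ := fun i b => if b = 1 then q i else 1 - q i
  let W₁ : ({i // i ∈ S} → ZMod 2) → ℝ := fun a => ∏ i : {i // i ∈ S}, w i (a i)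
  let W₂ : ({i // i ∉ S} → ZMod 2) → ℝ := fun b => ∏ i : {i // i ∉ S}, w i (b i)
  have hW : ∀ g : (ι → ZMod 2) → ℝ,
      expect q g = ∑ a, ∑ b, W₁ a * W₂ b * g (e.symm (a, b)) := by
    intro g
    rw [expect, ← e.symm.sum_comp, Fintype.sum_prod_type]
    refine Finset.sum_congr rfl fun a _ => Finset.sum_congr rfl fun b _ => ?_
    congr 1
    rw [← Fintype.prod_subtype_mul_prod_subtype (fun i => i ∈ S)]
    congr 1
    · refine Finset.prod_congr rfl fun i _ => ?_
      simp [e, w, i.2]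
    · refine Finset.prod_congr rfl fun i _ => ?_
      simp [e, w, i.2]
  have hf' : ∀ a b, f (e.symm (a, b)) = f (e.symm (a, 0)) := fun a b =>
    hf fun i hi => by simp [e, hi]
  have hh' : ∀ a b, h (e.symm (a, b)) = h (e.symm (0, b)) := fun a b =>
    hh fun i hi => by
      have hi : i ∉ S := hi
      simp [e, hi]
  have h1 : (∑ a, W₁ a) * ∑ b, W₂ b = 1 := by
    rw [Finset.sum_mul_sum, ← expect_one q, hW]
    simp
  have hfx : expect q f = (∑ a, W₁ a * f (e.symm (a, 0))) * ∑ b, W₂ b := by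
    rw [hW, Finset.sum_mul_sum]
    refine Finset.sum_congr rfl fun a _ => Finset.sum_congr rfl fun b _ => ?_
    rw [hf']; ring
  have hhx : expect q h = (∑ a, W₁ a) * ∑ b, W₂ b * h (e.symm (0, b)) := by
    rw [hW, Finset.sum_mul_sum]
    refine Finset.sum_congr rfl fun a _ => Finset.sum_congr rfl fun b _ => ?_
    rw [hh']; ring
  have hfh : expect q (fun z => f z * h z) =
      (∑ a, W₁ a * f (e.symm (a, 0))) * ∑ b, W₂ b * h (e.symm (0, b)) := by
    rw [hW, Finset.sum_mul_sum]
    refine Finset.sum_congr rfl fun a _ => Finset.sum_congr rfl fun b _ => ?_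
    rw [hf', hh']; ring
  rw [hfh, hfx, hhx]
  linear_combination (-(∑ a, W₁ a * f (e.symm (a, 0))) * ∑ b, W₂ b * h (e.symm (0, b))) * h1

theorem expect_finset_prod {κ : Type*} {q : ι → ℝ} (T : Finset κ) {f : κ → (ι → ZMod 2) → ℝ}
    {S : κ → Set ι} (hf : ∀ k ∈ T, DependsOn (f k) (S k))
    (hS : (T : Set κ).PairwiseDisjoint S) :
    expect q (fun z => ∏ k ∈ T, f k z) = ∏ k ∈ T, expect q (f k) := by
  classical
  induction T using Finset.induction_on with
  | empty => simpa using expect_one q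
  | insert k T hk ih =>
    simp only [Finset.prod_insert hk]
    rw [← ih (fun k hk => hf k (Finset.mem_insert_of_mem hk))
      (hS.subset (by simp))]
    refine expect_mul (hf k (Finset.mem_insert_self k T)) ?_
    intro x y hxy
    refine Finset.prod_congr rfl fun k' hk' => ?_
    refine hf k' (Finset.mem_insert_of_mem hk') fun i hi => hxy i fun hik => ?_
    exact Set.disjoint_left.1 (hS (by simp) (by simp [hk']) fun h : k = k' => hk (h ▸ hk')) hik hi

/-- Events that depend on disjoint sets of independent bits are independent. -/
theorem pr_biInter {κ : Type*} {q : ι → ℝ} (T : Finset κ) {E : κ → Set (ι → ZMod 2)}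
    {S : κ → Set ι} (hE : ∀ k ∈ T, DependsOn (· ∈ E k) (S k))
    (hS : (T : Set κ).PairwiseDisjoint S) :
    pr q (⋂ k ∈ T, E k) = ∏ k ∈ T, pr q (E k) := by
  classical
  have h : (⋂ k ∈ T, E k).indicator (1 : (ι → ZMod 2) → ℝ) =
      fun z => ∏ k ∈ T, (E k).indicator 1 z := by
    funext z
    simp only [Set.indicator_apply, Set.mem_iInter, Pi.one_apply, Finset.prod_ite_zero,
      Finset.prod_const_one]
  simp only [pr, h]
  refine expect_finset_prod T (fun k hk x y hxy => ?_) hS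
  have := hE k hk hxy
  simp only [eq_iff_iff] at this
  simp only [Set.indicator_apply, this, Pi.one_apply]

/-- The sign `(-1) ^ b` of a bit. -/
def sgn (b : ZMod 2) : ℝ := if b = 1 then -1 else 1

theorem sgn_add (a b : ZMod 2) : sgn (a + b) = sgn a * sgn b := by
  have h : ∀ b : ZMod 2, b = 0 ∨ b = 1 := by decide
  have h2 : (1 : ZMod 2) + 1 ≠ 1 := by decide
  have h3 : (0 : ZMod 2) ≠ 1 := by decide
  rcases h a with rfl | rfl <;> rcases h b with rfl | rfl <;> simp [sgn, h2, h3]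

theorem sgn_sum {κ : Type*} (T : Finset κ) (f : κ → ZMod 2) :
    sgn (∑ k ∈ T, f k) = ∏ k ∈ T, sgn (f k) := by
  classical
  induction T using Finset.induction_on with
  | empty => simp [sgn]
  | insert k T hk ih => rw [Finset.sum_insert hk, Finset.prod_insert hk, sgn_add, ih]

theorem sgn_le_one (b : ZMod 2) : sgn b ≤ 1 := by
  unfold sgn; split_ifs <;> norm_num

/-- The probability that a bit is wrong, in terms of the mean sign of its error. -/
theorem pr_ne_eq (q : ι → ℝ) (f : (ι → ZMod 2) → ZMod 2) (r : ZMod 2) :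
    pr q {z | f z ≠ r} = (1 - expect q (fun z => sgn (f z + r))) / 2 := by
  have h : ({z | f z ≠ r} : Set (ι → ZMod 2)).indicator (1 : (ι → ZMod 2) → ℝ) =
      fun z => (1 / 2) * (1 + (-1) * sgn (f z + r)) := by
    have hb : ∀ a b : ZMod 2, a ≠ b ↔ a + b = 1 := by decide
    funext z
    by_cases hz : f z + r = 1
    · rw [Set.indicator_of_mem ((hb _ _).2 hz)]
      simp [sgn, hz]; norm_num
    · rw [Set.indicator_of_notMem (fun hm => hz ((hb _ _).1 hm))]
      simp [sgn, hz]
  rw [pr, h, expect_const_mul, expect_add q (fun _ => 1), expect_one, expect_const_mul]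
  ring

theorem expect_sgn_apply (q : ι → ℝ) (j : ι) : expect q (fun z => sgn (z j)) = 1 - 2 * q j := by
  have h := pr_ne_eq q (fun z => z j) 0
  have h' : {z : ι → ZMod 2 | z j ≠ 0} = {z | z j = 1} := by
    have hb : ∀ a : ZMod 2, a ≠ 0 ↔ a = 1 := by decide
    ext z; simp [hb]
  rw [h', pr_apply_eq_one] at h
  simp only [add_zero] at h
  linarith

/-- A bit `m z + z j` inherits the failure probability `q j < 1/2` of its last gate, since `z j` is
independent of `m z`. -/
theorem le_pr_add_apply_ne {q : ι → ℝ} (h0 : ∀ i, 0 ≤ q i) (h1 : ∀ i, q i ≤ 1) {j : ι}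
    (hj : q j ≤ 1 / 2) {m : (ι → ZMod 2) → ZMod 2} (hm : DependsOn m {j}ᶜ) (r : ZMod 2) :
    q j ≤ pr q {z | m z + z j ≠ r} := by
  have hind : expect q (fun z => sgn (m z + z j + r)) =
      (1 - 2 * q j) * expect q (fun z => sgn (m z + r)) := by
    rw [← expect_sgn_apply, ← expect_mul (S := {j})]
    · congr 1; funext z
      rw [← sgn_add]; congr 1; ring
    · intro x y hxy
      simp [hxy j rfl]
    · intro x y hxy
      simp only [hm hxy]
  have hle : expect q (fun z => sgn (m z + r)) ≤ 1 := by
    rw [← expect_one q]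
    exact expect_mono h0 h1 fun z => sgn_le_one _
  rw [pr_ne_eq, hind]
  nlinarith

end Bernoulli

/-! ### Conditioning a circuit on its inputs and coins -/

namespace NoisyCircuit

variable {L K : ℕ}

/-- The probability of an event is the average, over the input, the tie-breaking bits and the
selection, of its probability with respect to the gate failures. -/
theorem prob_eq (C : NoisyCircuit L K) (p : GateKind → ℝ) (S : Set C.Outcome) :
    C.prob p S = ∑ s : Fin L → ZMod 2, ∑ coin : C.Gate → ZMod 2, ∑ a : C.Sel,
      ((1 / 2) ^ L * (1 / 2) ^ Fintype.card C.Gate * (1 / (Fintype.card C.Sel : ℝ))) *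
        pr (fun g => p (C.kind g)) {z | (s, z, coin, a) ∈ S} := by
  classical
  rw [prob, Fintype.sum_prod_type]
  refine Finset.sum_congr rfl fun s _ => ?_
  rw [Fintype.sum_prod_type_right, Fintype.sum_prod_type]
  refine Finset.sum_congr rfl fun coin _ => Finset.sum_congr rfl fun a _ => ?_
  rw [pr, expect, Finset.mul_sum]
  refine Finset.sum_congr rfl fun z _ => ?_
  by_cases h : (s, z, coin, a) ∈ S
  · rw [if_pos h, Set.indicator_of_mem (by exact h), mass]
    simp only [Pi.one_apply]
    ring
  · rw [if_neg h, Set.indicator_of_notMem (by exact h), mul_zero, mul_zero]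

theorem sum_selection_weight (C : NoisyCircuit L K) [Nonempty C.Sel] (B : ℝ) :
    ∑ _s : Fin L → ZMod 2, ∑ _coin : C.Gate → ZMod 2, ∑ _a : C.Sel,
      ((1 / 2) ^ L * (1 / 2) ^ Fintype.card C.Gate * (1 / (Fintype.card C.Sel : ℝ))) * B = B := by
  have h : (Fintype.card C.Sel : ℝ) ≠ 0 := by exact_mod_cast Fintype.card_ne_zero
  simp only [Finset.sum_const, Finset.card_univ, Fintype.card_pi, ZMod.card, Finset.prod_const,
    Fintype.card_fin, nsmul_eq_mul]
  push_cast
  have h2 : ∀ n : ℕ, (2 : ℝ) ^ n * (1 / 2) ^ n = 1 := fun n => by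
    rw [← mul_pow]; norm_num
  have h3 : (Fintype.card C.Sel : ℝ) * (1 / Fintype.card C.Sel) = 1 := by field_simp
  calc _ = ((2 : ℝ) ^ L * (1 / 2) ^ L) *
        ((2 : ℝ) ^ Fintype.card C.Gate * (1 / 2) ^ Fintype.card C.Gate) *
        ((Fintype.card C.Sel : ℝ) * (1 / Fintype.card C.Sel)) * B := by ring
    _ = B := by rw [h2, h2, h3]; ring

theorem prob_le (C : NoisyCircuit L K) [Nonempty C.Sel] {p : GateKind → ℝ} {S : Set C.Outcome}
    {B : ℝ} (h : ∀ s coin a, pr (fun g => p (C.kind g)) {z | (s, z, coin, a) ∈ S} ≤ B) :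
    C.prob p S ≤ B := by
  rw [prob_eq]
  refine le_trans ?_ (C.sum_selection_weight B).le
  refine Finset.sum_le_sum fun s _ => Finset.sum_le_sum fun coin _ => Finset.sum_le_sum fun a _ => ?_
  exact mul_le_mul_of_nonneg_left (h s coin a) (by positivity)

theorem le_prob (C : NoisyCircuit L K) [Nonempty C.Sel] {p : GateKind → ℝ} {S : Set C.Outcome}
    {B : ℝ} (h : ∀ s coin a, B ≤ pr (fun g => p (C.kind g)) {z | (s, z, coin, a) ∈ S}) :
    B ≤ C.prob p S := by
  rw [prob_eq]
  refine (C.sum_selection_weight B).ge.trans ?_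
  refine Finset.sum_le_sum fun s _ => Finset.sum_le_sum fun coin _ => Finset.sum_le_sum fun a _ => ?_
  exact mul_le_mul_of_nonneg_left (h s coin a) (by positivity)

theorem bitErrorProb_le (C : NoisyCircuit L K) [Nonempty C.Sel] (hK : 0 < K)
    {A : Matrix (Fin L) (Fin K) (ZMod 2)} {p : GateKind → ℝ} {B : ℝ}
    (h : ∀ k s coin a, pr (fun g => p (C.kind g))
      {z | wireVal s (C.eval s z coin) (C.out a k) ≠ Matrix.vecMul s A k} ≤ B) :
    C.bitErrorProb A p ≤ B := by
  rw [bitErrorProb, div_le_iff₀ (by exact_mod_cast hK)]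
  refine (Finset.sum_le_card_nsmul _ _ B fun k _ => C.prob_le (h k)).trans_eq ?_
  simp [mul_comm]

theorem le_bitErrorProb (C : NoisyCircuit L K) [Nonempty C.Sel] (hK : 0 < K)
    {A : Matrix (Fin L) (Fin K) (ZMod 2)} {p : GateKind → ℝ} {B : ℝ}
    (h : ∀ k s coin a, B ≤ pr (fun g => p (C.kind g))
      {z | wireVal s (C.eval s z coin) (C.out a k) ≠ Matrix.vecMul s A k}) :
    B ≤ C.bitErrorProb A p := by
  rw [bitErrorProb, le_div_iff₀ (by exact_mod_cast hK)]
  refine le_trans (Eq.le ?_) (Finset.card_nsmul_le_sum _ _ B fun k _ => C.le_prob (h k))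
  simp [mul_comm]

/-- The output of a gate depends only on the failures in a set that contains the gate and is closed
under passing to the gates whose outputs are read. The sets may be different for different gates. -/
theorem dependsOn_eval (C : NoisyCircuit L K) (s : Fin L → ZMod 2) (coin : C.Gate → ZMod 2)
    (S : C.Gate → Set C.Gate) (hself : ∀ g, g ∈ S g)
    (hins : ∀ g g', Wire.gate g' ∈ C.ins g → S g' ⊆ S g) (g : C.Gate) :
    DependsOn (fun z => C.eval s z coin g) (S g) := by
  intro x y hxy
  induction hn : C.time g using Nat.strong_induction_on generalizing g with
  | _ n ih =>
    subst hn
    simp only [C.eval_eq s _ coin g]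
    rw [hxy g (hself g)]
    congr 2
    refine Multiset.map_congr rfl fun w hw => ?_
    cases w with
    | input l => rfl
    | const b => rfl
    | gate g' => exact ih _ (C.feasible g g' hw) g' (fun i hi => hxy i (hins g g' hw hi)) rfl

/-- A gate whose failure probability is below `1/2` is wrong at least that often, whatever value it
is meant to have. -/
theorem le_pr_eval_ne (C : NoisyCircuit L K) {p : GateKind → ℝ} (h0 : ∀ k, 0 ≤ p k)
    (h1 : ∀ k, p k ≤ 1 / 2) (s : Fin L → ZMod 2) (coin : C.Gate → ZMod 2) (g : C.Gate)
    (r : ZMod 2) :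
    p (C.kind g) ≤ pr (fun g => p (C.kind g)) {z | C.eval s z coin g ≠ r} := by
  simp only [C.eval_eq s _ coin g]
  refine le_pr_add_apply_ne (fun _ => h0 _) (fun _ => (h1 _).trans (by norm_num)) (h1 _) ?_ r
  intro x y hxy
  have hdep := C.dependsOn_eval s coin (fun g' => {g'' | C.time g'' ≤ C.time g'})
    (fun g => le_refl (C.time g)) (fun a b hab c hc => le_trans hc (C.feasible a b hab).le)
  beta_reduce
  congr 1
  refine Multiset.map_congr rfl fun w hw => ?_
  cases w with
  | input l => rfl
  | const b => rfl
  | gate g' =>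
    refine hdep g' fun i hi => hxy i ?_
    rintro rfl
    exact absurd (C.feasible _ g' hw) (not_lt.2 hi)

end NoisyCircuit

theorem IsTradeoff.energyInv_le_iff {ε : ℝ → ℝ} (hε : IsTradeoff ε) {p E : ℝ}
    (hp : p ∈ ε '' Set.Ioi 0) (hE : 0 < E) : energyInv ε p ≤ E ↔ ε E ≤ p := by
  have h1 : energyInv ε p ∈ Set.Ioi (0 : ℝ) := Function.invFunOn_mem hp
  have h2 : ε (energyInv ε p) = p := Function.invFunOn_eq hp
  conv_rhs => rw [← h2]
  exact (hε.anti.le_iff_ge hE h1).symm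

theorem energyInv_pos {ε : ℝ → ℝ} {p : ℝ} (hp : p ∈ ε '' Set.Ioi 0) : 0 < energyInv ε p :=
  Function.invFunOn_mem hp

/-! ### The uncoded scheme -/

theorem sum_filter_lt_succ {M : Type*} [AddCommMonoid M] {n m : ℕ} (hm : m < n) (f : Fin n → M) :
    ∑ i with i.1 < m + 1, f i = ∑ i with i.1 < m, f i + f ⟨m, hm⟩ := by
  have h : (Finset.univ.filter fun i : Fin n => i.1 < m + 1) =
      insert ⟨m, hm⟩ (Finset.univ.filter fun i : Fin n => i.1 < m) := by
    ext i
    simp only [Finset.mem_filter, Finset.mem_univ, true_and, Finset.mem_insert, Fin.ext_iff]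
    omega
  rw [h, Finset.sum_insert (by simp), add_comm]

theorem uncoded_eval_and {L K : ℕ} (hL : 2 ≤ L) (A : Matrix (Fin L) (Fin K) (ZMod 2))
    (s : Fin L → ZMod 2) (z coin : UGate L K → ZMod 2) (k : Fin K) (l : Fin L) :
    (uncoded hL A).eval s z coin (k, .inl l) = s l * A l k + z (k, .inl l) := by
  refine ((uncoded hL A).eval_eq s z coin (k, .inl l)).trans ?_
  simp [uncoded, gateFn, NoisyCircuit.wireVal]

@[to_additive]
theorem prod_map_pair {α M : Type*} [CommMonoid M] (f : α → M) (a b : α) :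
    (({a, b} : Multiset α).map f).prod = f a * f b := by
  simp

theorem uncoded_eval_chain {L K : ℕ} (hL : 2 ≤ L) (A : Matrix (Fin L) (Fin K) (ZMod 2))
    (s : Fin L → ZMod 2) (z coin : UGate L K → ZMod 2) (k : Fin K) (j : ℕ) (hj : j < L - 1) :
    (uncoded hL A).eval s z coin (k, .inr ⟨j, hj⟩) =
      (if j = 0 then (uncoded hL A).eval s z coin (k, .inl ⟨0, by omega⟩)
        else (uncoded hL A).eval s z coin (k, .inr ⟨j - 1, by omega⟩)) +
      (uncoded hL A).eval s z coin (k, .inl ⟨j + 1, by omega⟩) + z (k, .inr ⟨j, hj⟩) := by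
  refine ((uncoded hL A).eval_eq s z coin (k, .inr ⟨j, hj⟩)).trans ?_
  congr 1
  change gateFn .xor _ (Multiset.map _ {_, _}) = _
  refine (sum_map_pair _ _ _).trans ?_
  by_cases h : j = 0
  · simp only [h, if_true]
    rfl
  · simp only [h, if_false]
    rfl

theorem uncoded_eval_xor {L K : ℕ} (hL : 2 ≤ L) (A : Matrix (Fin L) (Fin K) (ZMod 2))
    (s : Fin L → ZMod 2) (z coin : UGate L K → ZMod 2) (k : Fin K) (j : ℕ) (hj : j < L - 1) :
    (uncoded hL A).eval s z coin (k, .inr ⟨j, hj⟩) =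
      ∑ l with l.1 < j + 2, (s l * A l k + z (k, .inl l)) +
        ∑ i with i.1 < j + 1, z (k, .inr i) := by
  induction j with
  | zero =>
    rw [sum_filter_lt_succ (m := 0 + 1) (by omega), sum_filter_lt_succ (m := 0) (by omega),
      sum_filter_lt_succ (m := 0) hj, uncoded_eval_chain, if_pos rfl, uncoded_eval_and,
      uncoded_eval_and]
    simp
  | succ j ih =>
    rw [sum_filter_lt_succ (m := j + 2) (by omega), sum_filter_lt_succ (m := j + 1) hj,
      uncoded_eval_chain, if_neg (Nat.succ_ne_zero j), uncoded_eval_and]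
    simp only [Nat.add_sub_cancel]
    rw [ih]
    ring

/-- An output bit is wrong if and only if an odd number of the `2 L - 1` gates that compute it
fail. -/
theorem uncoded_error_prob {L K : ℕ} (hL : 2 ≤ L) (A : Matrix (Fin L) (Fin K) (ZMod 2))
    (p : GateKind → ℝ) (s : Fin L → ZMod 2) (coin : UGate L K → ZMod 2) (k : Fin K) :
    pr (fun g => p ((uncoded hL A).kind g))
      {z | NoisyCircuit.wireVal s ((uncoded hL A).eval s z coin) ((uncoded hL A).out () k) ≠
        Matrix.vecMul s A k} =
      (1 - (1 - 2 * p .and) ^ L * (1 - 2 * p .xor) ^ (L - 1)) / 2 := by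
  have hev : ∀ z : UGate L K → ZMod 2,
      NoisyCircuit.wireVal s ((uncoded hL A).eval s z coin) ((uncoded hL A).out () k) +
        Matrix.vecMul s A k = ∑ g, z (k, g) := by
    intro z
    have h := uncoded_eval_xor hL A s z coin k (L - 2) (by omega)
    have h1 : (Finset.univ.filter fun l : Fin L => l.1 < L - 2 + 2) = Finset.univ :=
      Finset.filter_true_of_mem fun l _ => by omega
    have h2 : (Finset.univ.filter fun l : Fin (L - 1) => l.1 < L - 2 + 1) = Finset.univ :=
      Finset.filter_true_of_mem fun l _ => by omega
    rw [h1, h2, Finset.sum_add_distrib] at h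
    change (uncoded hL A).eval s z coin (k, .inr ⟨L - 2, by omega⟩) + _ = _
    rw [h, Fintype.sum_sum_type]
    have h3 : Matrix.vecMul s A k = ∑ l, s l * A l k := rfl
    have h4 := CharTwo.add_self_eq_zero (∑ l, s l * A l k)
    rw [h3]
    linear_combination h4
  rw [pr_ne_eq]
  congr 2
  have h1 : ∀ z : UGate L K → ZMod 2,
      sgn (NoisyCircuit.wireVal s ((uncoded hL A).eval s z coin) ((uncoded hL A).out () k) +
        Matrix.vecMul s A k) = ∏ g, sgn (z (k, g)) := fun z => by rw [hev, sgn_sum]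
  refine (congrArg _ (funext h1)).trans ?_
  refine (expect_finset_prod (ι := UGate L K) Finset.univ (S := fun g => {(k, g)})
    (fun g _ x y hxy => ?_) (fun g _ g' _ hg => ?_)).trans ?_
  · simp [hxy (k, g) rfl]
  · simpa using hg
  · refine (Finset.prod_congr rfl fun g _ => expect_sgn_apply (ι := UGate L K) _ (k, g)).trans ?_
    simp [Fintype.prod_sum_type, uncoded]

theorem one_sub_inv_pow_le (n : ℕ) :
    (1 - 1 / ((n : ℝ) + 1)) ^ (n + 1) ≤ n / (2 * ((n : ℝ) + 1)) := by
  rcases Nat.eq_zero_or_pos n with rfl | hn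
  · simp
  have hn' : (0 : ℝ) < n := by exact_mod_cast hn
  have hB : (2 : ℝ) ≤ (1 + 1 / (n : ℝ)) ^ n := by
    have h := one_add_mul_le_pow (a := 1 / (n : ℝ)) (by have : 0 < 1 / (n : ℝ) := by positivity
                                                        linarith) n
    have h' : (n : ℝ) * (1 / n) = 1 := by field_simp
    linarith
  have h1 : (1 - 1 / ((n : ℝ) + 1)) = (1 + 1 / (n : ℝ))⁻¹ := by field_simp; ring
  have h2 : (1 - 1 / ((n : ℝ) + 1)) = n / ((n : ℝ) + 1) := by field_simp; ring
  rw [pow_succ]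
  nth_rw 1 [h1]
  rw [h2, inv_pow]
  have h3 : ((1 + 1 / (n : ℝ)) ^ n)⁻¹ ≤ 1 / 2 := by
    rw [one_div (2 : ℝ)]
    exact inv_anti₀ (by norm_num) hB
  calc _ ≤ 1 / 2 * ((n : ℝ) / (n + 1)) := mul_le_mul_of_nonneg_right h3 (by positivity)
    _ = _ := by field_simp

/-- As the left-hand side is convex in `e`, it suffices to compare the two sides at `e = 0` and at
`e = 1 / (2 m)`. -/
theorem one_sub_two_mul_pow_le {m : ℕ} (hm : 1 ≤ m) {e : ℝ} (h0 : 0 ≤ e)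
    (h1 : e ≤ 1 / (2 * (m : ℝ))) : (1 - 2 * e) ^ m ≤ 1 - (m + 1) * e := by
  obtain ⟨n, rfl⟩ : ∃ n, m = n + 1 := ⟨m - 1, by omega⟩
  push_cast at h1 ⊢
  have hn : (0 : ℝ) < (n : ℝ) + 1 := by positivity
  have hl : 2 * ((n : ℝ) + 1) * e ≤ 1 := by
    rw [le_div_iff₀ (by positivity)] at h1
    linarith
  have hx : (0 : ℝ) ≤ 1 - 1 / ((n : ℝ) + 1) := by
    have : 1 / ((n : ℝ) + 1) ≤ 1 := by
      rw [div_le_one hn]; linarith [(Nat.cast_nonneg n : (0 : ℝ) ≤ n)]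
    linarith
  have hc := (convexOn_pow (𝕜 := ℝ) (n + 1)).2 (Set.mem_Ici.2 zero_le_one) (Set.mem_Ici.2 hx)
    (sub_nonneg.2 hl) (by positivity : 0 ≤ 2 * ((n : ℝ) + 1) * e) (by ring)
  simp only [smul_eq_mul, one_pow, mul_one] at hc
  have hpt : 1 - 2 * ((n : ℝ) + 1) * e + 2 * ((n : ℝ) + 1) * e * (1 - 1 / ((n : ℝ) + 1)) =
      1 - 2 * e := by field_simp; ring
  rw [hpt] at hc
  refine hc.trans ?_
  have := mul_le_mul_of_nonneg_left (one_sub_inv_pow_le n)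
    (by positivity : 0 ≤ 2 * ((n : ℝ) + 1) * e)
  have h5 : 2 * ((n : ℝ) + 1) * e * (n / (2 * ((n : ℝ) + 1))) = n * e := by field_simp
  linarith

theorem uncoded_gate_bound {L K : ℕ} (hL : 2 ≤ L) (hK : 0 < K)
    (A : Matrix (Fin L) (Fin K) (ZMod 2)) {p : GateKind → ℝ} (h0 : ∀ k, 0 ≤ p k)
    (hp : max (p .and) (p .xor) < 1 / (2 * (L : ℝ) - 2)) :
    L / 2 * max (p .and) (p .xor) ≤ (uncoded hL A).bitErrorProb A p := by
  have : Nonempty (uncoded hL A).Sel := ⟨()⟩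
  refine NoisyCircuit.le_bitErrorProb _ hK fun k s coin a => ?_
  refine le_trans ?_ (uncoded_error_prob hL A p s coin k).ge
  have hL1 : ((L - 1 : ℕ) : ℝ) = (L : ℝ) - 1 := by
    rw [Nat.cast_sub (by omega)]; simp
  have hL2 : (2 : ℝ) ≤ L := by exact_mod_cast hL
  have hhalf : 1 / (2 * (L : ℝ) - 2) ≤ 1 / 2 :=
    one_div_le_one_div_of_le (by norm_num) (by linarith)
  have hb : ∀ e, 0 ≤ e → e ≤ max (p .and) (p .xor) →
      0 ≤ 1 - 2 * e ∧ (1 - 2 * e) ^ (L - 1) ≤ 1 - L * e := by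
    intro e he0 he1
    refine ⟨by linarith, ?_⟩
    have h := one_sub_two_mul_pow_le (m := L - 1) (by omega) he0 (by
      rw [hL1]
      have : 2 * ((L : ℝ) - 1) = 2 * L - 2 := by ring
      rw [this]
      linarith)
    rw [hL1] at h
    linarith
  obtain ⟨ha0, ha⟩ := hb _ (h0 .and) (le_max_left _ _)
  obtain ⟨hx0, hx⟩ := hb _ (h0 .xor) (le_max_right _ _)
  have ha1 : (1 - 2 * p .and) ^ L ≤ (1 - 2 * p .and) ^ (L - 1) :=
    pow_le_pow_of_le_one ha0 (by linarith [h0 .and]) (by omega)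
  have ha2 : (1 - 2 * p .and) ^ L ≤ 1 := pow_le_one₀ ha0 (by linarith [h0 .and])
  have hx2 : (1 - 2 * p .xor) ^ (L - 1) ≤ 1 := pow_le_one₀ hx0 (by linarith [h0 .xor])
  have ha3 : 0 ≤ (1 - 2 * p .and) ^ L := pow_nonneg ha0 _
  have hx3 : 0 ≤ (1 - 2 * p .xor) ^ (L - 1) := pow_nonneg hx0 _
  rcases max_cases (p .and) (p .xor) with ⟨h, _⟩ | ⟨h, _⟩ <;> rw [h]
  · nlinarith [mul_le_mul_of_nonneg_left hx2 ha3]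
  · nlinarith [mul_le_mul_of_nonneg_right ha2 hx3]

theorem uncoded_energy_ge {L K : ℕ} (hL : 2 ≤ L) (hK : 0 < K)
    (A : Matrix (Fin L) (Fin K) (ZMod 2)) {Ev : ℝ} (hE : 0 < Ev) :
    L * Ev ≤ (uncoded hL A).energyPerBit Ev := by
  have hK' : (0 : ℝ) < K := by exact_mod_cast hK
  have hcard : Fintype.card (uncoded hL A).Gate = K * (L + (L - 1)) := by
    change Fintype.card (UGate L K) = _
    simp
  rw [NoisyCircuit.energyPerBit, hcard, le_div_iff₀ hK']
  have : (L : ℝ) ≤ ((L + (L - 1) : ℕ) : ℝ) := by exact_mod_cast Nat.le_add_right _ _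
  have h2 := mul_le_mul_of_nonneg_right this (mul_pos hK' hE).le
  rw [Nat.cast_mul]
  linarith

/-! ### ENCODED-T: energy and the failures at the root -/

section EncodedT

variable {L K N dv dc dT : ℕ}

theorem encodedT_card (hL : 2 ≤ L) (hT : 2 ≤ dT) (𝒞 : LDPCCode N K dv dc)
    (A : Matrix (Fin L) (Fin K) (ZMod 2)) :
    Fintype.card (encodedT hL hT 𝒞 A).Gate =
      L * (N * dv) + numInner L dT * (3 * (N * dv)) := by
  change Fintype.card (TGate L N dv dT) = _
  have : Fintype.card Step = 3 := rfl
  simp [this]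

theorem numInner_le_iff (hT : 2 ≤ dT) {n : ℕ} : numInner L dT ≤ n ↔ L - 1 ≤ (dT - 1) * n :=
  ceilDiv_le_iff_le_mul (by omega)

theorem encodedT_energy_ge (hL : 2 ≤ L) (hT : 2 ≤ dT) (hdv : 4 ≤ dv) (hK : 0 < K)
    (𝒞 : LDPCCode N K dv dc) (A : Matrix (Fin L) (Fin K) (ZMod 2)) {Ev : ℝ} (hE : 0 < Ev) :
    L * N / K * Ev ≤ (encodedT hL hT 𝒞 A).energyPerBit Ev := by
  have hK' : (0 : ℝ) < K := by exact_mod_cast hK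
  rw [NoisyCircuit.energyPerBit, encodedT_card, div_mul_eq_mul_div]
  gcongr
  have : L * N ≤ L * (N * dv) + numInner L dT * (3 * (N * dv)) := by
    refine le_trans ?_ (Nat.le_add_right _ _)
    exact Nat.mul_le_mul_left _ (Nat.le_mul_of_pos_right _ (by omega))
  exact_mod_cast this

theorem encodedT_energy_le (hL : 2 ≤ L) (hT : 2 ≤ dT) (hK : 0 < K) {D : ℕ} (hD : dv ≤ D)
    (𝒞 : LDPCCode N K dv dc) (A : Matrix (Fin L) (Fin K) (ZMod 2)) {Ev : ℝ} (hE : 0 < Ev) :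
    (encodedT hL hT 𝒞 A).energyPerBit Ev ≤ 4 * D * (L * N / K * Ev) := by
  have hK' : (0 : ℝ) < K := by exact_mod_cast hK
  have hS : numInner L dT ≤ L := by
    rw [numInner_le_iff hT]
    exact (Nat.sub_le _ _).trans (Nat.le_mul_of_pos_left _ (by omega))
  rw [NoisyCircuit.energyPerBit, encodedT_card]
  have h : L * (N * dv) + numInner L dT * (3 * (N * dv)) ≤ 4 * D * (L * N) := by
    calc _ ≤ L * (N * D) + L * (3 * (N * D)) := by gcongr
      _ = _ := by ring
  have h' : ((L * (N * dv) + numInner L dT * (3 * (N * dv)) : ℕ) : ℝ) ≤ 4 * D * (L * N) := by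
    exact_mod_cast h
  calc _ ≤ 4 * D * (L * N) * Ev / K := by gcongr
    _ = _ := by ring

theorem encodedT_maj_le (hL : 2 ≤ L) (hT : 2 ≤ dT) (hdv : 4 ≤ dv) (hK : 0 < K)
    (𝒞 : LDPCCode N K dv dc) (A : Matrix (Fin L) (Fin K) (ZMod 2)) {p : GateKind → ℝ}
    (h0 : ∀ k, 0 ≤ p k) (h1 : ∀ k, p k ≤ 1 / 2) :
    p .maj ≤ (encodedT hL hT 𝒞 A).bitErrorProb A p := by
  have : Nonempty (encodedT hL hT 𝒞 A).Sel := ⟨(⟨0, by omega⟩ : Fin dv)⟩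
  exact NoisyCircuit.le_bitErrorProb _ hK fun k s coin a =>
    (encodedT hL hT 𝒞 A).le_pr_eval_ne h0 h1 s coin
      (.inr (⟨0, numInner_pos hL hT⟩, .vote, (Fin.castLE 𝒞.dim_le k, a))) _

end EncodedT

/-! ### Closed walks without backtracking and the girth -/

/-- A walk that never uses an edge twice in a row is a path unless the graph has a cycle that is at
most as long as the walk. -/
theorem isPath_or_exists_isCycle {V : Type*} {G : SimpleGraph V} {u v : V} (w : G.Walk u v)
    (hw : w.edges.IsChain (· ≠ ·)) :
    w.IsPath ∨ ∃ (x : V) (c : G.Walk x x), c.IsCycle ∧ c.length ≤ w.length := by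
  classical
  induction w with
  | nil => exact .inl SimpleGraph.Walk.IsPath.nil
  | @cons u v t h p ih =>
    rw [SimpleGraph.Walk.edges_cons] at hw
    rcases ih hw.tail with hp | ⟨x, c, hc, hlen⟩
    swap
    · exact .inr ⟨x, c, hc, hlen.trans (by simp)⟩
    by_cases hu : u ∈ p.support
    swap
    · exact .inl ((SimpleGraph.Walk.cons_isPath_iff h p).2 ⟨hp, hu⟩)
    have hq : (p.takeUntil u hu).IsPath := hp.takeUntil hu
    have hpre := p.edges_takeUntil_prefix_edges hu
    have hlen := p.length_takeUntil_le_length hu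
    refine .inr ⟨u, .cons h (p.takeUntil u hu), ?_, by simpa using hlen⟩
    rw [SimpleGraph.Walk.cons_isCycle_iff]
    refine ⟨hq, fun hmem => ?_⟩
    generalize p.takeUntil u hu = q at hq hpre hmem
    -- A path from `v` to `u` that uses the edge `uv` starts with it, which is backtracking.
    cases q with
    | nil => simp at hmem
    | @cons _ x _ h' q' =>
      rw [SimpleGraph.Walk.cons_isPath_iff] at hq
      rw [SimpleGraph.Walk.edges_cons] at hpre hmem
      obtain ⟨l, hl⟩ := hpre
      rw [← hl, List.cons_append, List.isChain_cons_cons] at hw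
      rcases List.mem_cons.1 hmem with h1 | h1
      · exact hw.1 h1
      · exact hq.2 (q'.snd_mem_support_of_mem_edges h1)

section Tanner

variable {N K dv dc : ℕ} (𝒞 : LDPCCode N K dv dc)

/-- The end of an edge of the Tanner graph at which step `r` of a message path turns: the variable
node for even `r`, the parity check node for odd `r`. -/
def LDPCCode.turn (r : ℕ) (e : Edge N dv) : Fin N ⊕ Fin 𝒞.numChecks :=
  if Even r then .inl e.1 else .inr (𝒞.chk e)

/-- An edge of `𝒞` as an edge of the simple graph `𝒞.tanner`. -/
def LDPCCode.tannerEdge (e : Edge N dv) : Sym2 (Fin N ⊕ Fin 𝒞.numChecks) :=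
  s(.inl e.1, .inr (𝒞.chk e))

theorem LDPCCode.tannerEdge_injective : Function.Injective 𝒞.tannerEdge := by
  rintro ⟨v, a⟩ ⟨v', a'⟩ h
  simp only [tannerEdge, Sym2.eq_iff, Sum.inl.injEq, Sum.inr.injEq, reduceCtorEq, and_false,
    or_false] at h
  obtain ⟨rfl, h⟩ := h
  rw [𝒞.chk_inj v h]

theorem LDPCCode.tanner_adj (e : Edge N dv) :
    𝒞.tanner.Adj (.inl e.1) (.inr (𝒞.chk e)) := by
  simp only [tanner, SimpleGraph.fromRel_adj]
  exact ⟨by simp, .inl ⟨e, rfl, rfl⟩⟩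

theorem LDPCCode.adj_turn_succ (r : ℕ) (e : Edge N dv) :
    𝒞.tanner.Adj (𝒞.turn (r + 1) e) (𝒞.turn r e) := by
  by_cases h : Even r <;> simp only [turn, Nat.even_add_one, h, not_true, not_false_iff, if_true,
    if_false]
  · exact (𝒞.tanner_adj e).symm
  · exact 𝒞.tanner_adj e

theorem LDPCCode.mk_turn_succ (r : ℕ) (e : Edge N dv) :
    s(𝒞.turn (r + 1) e, 𝒞.turn r e) = 𝒞.tannerEdge e := by
  by_cases h : Even r <;> simp [turn, tannerEdge, Nat.even_add_one, h]

/-- `𝒞.MessagePath r e r' f`: the edge `e` at step `r` is joined to the edge `f` at step `r'` by a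
sequence of edges of the Tanner graph in which successive edges are different and share their
variable node (at even steps) or their parity check node (at odd steps). Along such paths a message
of Gallager-B decoding depends on earlier messages. -/
inductive LDPCCode.MessagePath : ℕ → Edge N dv → ℕ → Edge N dv → Prop
  | refl (r : ℕ) (e : Edge N dv) : MessagePath r e r e
  | step {r r' : ℕ} {e g f : Edge N dv} : 𝒞.turn r g = 𝒞.turn r e → g ≠ e →
      MessagePath (r + 1) g r' f → MessagePath r e r' f

variable {𝒞}

theorem LDPCCode.MessagePath.le {r r' : ℕ} {e f : Edge N dv} (h : 𝒞.MessagePath r e r' f) :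
    r ≤ r' := by
  induction h with
  | refl => exact le_rfl
  | step _ _ _ ih => omega

/-- Two message paths that end on the same edge can be continued, on both sides of a walk that
connects their starting edges, until they meet. -/
theorem LDPCCode.MessagePath.exists_closed_walk {r r' : ℕ} {e f : Edge N dv}
    (h : 𝒞.MessagePath r e r' f) :
    ∀ {e' : Edge N dv}, 𝒞.MessagePath r e' r' f → e ≠ e' →
    ∀ {x y : Fin N ⊕ Fin 𝒞.numChecks} (w : 𝒞.tanner.Walk x y), x = 𝒞.turn r e → y = 𝒞.turn r e' →
      w.edges.IsChain (· ≠ ·) → w.edges.head? = some (𝒞.tannerEdge e) →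
      w.edges.getLast? = some (𝒞.tannerEdge e') →
      ∃ (u : Fin N ⊕ Fin 𝒞.numChecks) (c : 𝒞.tanner.Walk u u), c.edges.IsChain (· ≠ ·) ∧
        0 < c.length ∧ c.length + 2 * r + 2 ≤ w.length + 2 * r' := by
  induction h with
  | refl r e =>
    intro e' h' hne
    cases h' with
    | refl => exact absurd rfl hne
    | step _ _ h' => exact absurd h'.le (by omega)
  | @step r r' e g f hg hge hgf ih =>
    intro e' h' hne x y w hx hy hw hhead hlast
    have hr := hgf.le
    by_cases hxy : x = y
    · subst hxy
      refine ⟨x, w, hw, ?_, by omega⟩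
      rw [← w.length_edges, List.length_pos_iff]
      rintro h0
      simp [h0] at hhead
    cases h' with
    | refl => omega
    | @step _ _ _ g' _ hg' hge' hgf' =>
      rw [← hg] at hx
      rw [← hg'] at hy
      have hgg' : g ≠ g' := fun h => hxy (by rw [hx, hy, h])
      subst hx hy
      obtain ⟨u, c, hc, hpos, hlen⟩ := ih hgf' hgg'
        ((SimpleGraph.Walk.cons (𝒞.adj_turn_succ r g) w).concat (𝒞.adj_turn_succ r g').symm) rfl rfl
        (by
          rw [SimpleGraph.Walk.edges_concat, SimpleGraph.Walk.edges_cons, 𝒞.mk_turn_succ,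
            Sym2.eq_swap, 𝒞.mk_turn_succ, List.concat_eq_append, List.isChain_append,
            List.isChain_cons]
          refine ⟨⟨?_, hw⟩, List.isChain_singleton _, ?_⟩
          · simp only [hhead, Option.mem_some_iff, forall_eq']
            exact 𝒞.tannerEdge_injective.ne hge
          · simp only [List.getLast?_cons, hlast, Option.getD_some, Option.mem_some_iff, forall_eq',
              List.head?_cons]
            exact 𝒞.tannerEdge_injective.ne hge'.symm)
        (by
          rw [SimpleGraph.Walk.edges_concat, SimpleGraph.Walk.edges_cons, 𝒞.mk_turn_succ]
          simp)
        (by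
          rw [SimpleGraph.Walk.edges_concat, Sym2.eq_swap, 𝒞.mk_turn_succ, List.concat_eq_append,
            List.getLast?_append]
          rfl)
      refine ⟨u, c, hc, hpos, ?_⟩
      rw [SimpleGraph.Walk.length_concat, SimpleGraph.Walk.length_cons] at hlen
      omega

/-- If the message paths that leave a variable node along two different edges meet again, there is a
short cycle. -/
theorem LDPCCode.MessagePath.exists_isCycle {r r' : ℕ} (hr : Odd r) {v : Fin N} {a b : Fin dv}
    {f : Edge N dv} (ha : 𝒞.MessagePath r (v, a) r' f) (hb : 𝒞.MessagePath r (v, b) r' f)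
    (hab : a ≠ b) :
    ∃ (u : Fin N ⊕ Fin 𝒞.numChecks) (c : 𝒞.tanner.Walk u u), c.IsCycle ∧
      c.length + 2 * r ≤ 2 * r' := by
  have hr' : ¬ Even r := Nat.not_even_iff_odd.2 hr
  have hne : ((v, a) : Edge N dv) ≠ (v, b) := fun h => hab (Prod.ext_iff.1 h).2
  obtain ⟨u, c, hc, hpos, hlen⟩ := ha.exists_closed_walk hb hne
    (.cons (𝒞.tanner_adj (v, a)).symm (.cons (𝒞.tanner_adj (v, b)) .nil))
    (by simp [turn, hr']) (by simp [turn, hr'])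
    (by
      simp only [SimpleGraph.Walk.edges_cons, SimpleGraph.Walk.edges_nil, List.isChain_cons_cons,
        List.isChain_singleton, and_true]
      rw [Sym2.eq_swap]
      exact 𝒞.tannerEdge_injective.ne hne)
    (by
      simp only [SimpleGraph.Walk.edges_cons, List.head?_cons]
      rw [Sym2.eq_swap]; rfl)
    (by simp [tannerEdge])
  simp only [SimpleGraph.Walk.length_cons, SimpleGraph.Walk.length_nil] at hlen
  rcases isPath_or_exists_isCycle c hc with hp | ⟨x, c', hc', hlen'⟩
  · rw [SimpleGraph.Walk.isPath_iff_nil, ← SimpleGraph.Walk.length_eq_zero_iff] at hp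
    omega
  · exact ⟨x, c', hc', by omega⟩

theorem girthConst_le_one (hdv : 4 ≤ dv) (hdc : dv ≤ dc) : girthConst dv dc ≤ 1 := by
  have h1 : (4 : ℝ) ≤ dv := by exact_mod_cast hdv
  have h2 : (dv : ℝ) ≤ dc := by exact_mod_cast hdc
  have h3 : 0 ≤ Real.log (((dc : ℝ) * dv - dc - dv) / (2 * dc)) := by
    refine Real.log_nonneg ?_
    rw [le_div_iff₀ (by linarith)]
    nlinarith
  have h4 : 0 ≤ Real.log (((dv : ℝ) - 1) * ((dc : ℝ) - 1)) := Real.log_nonneg (by nlinarith)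
  have := div_nonneg h3 h4
  rw [girthConst]
  linarith

/-- Up to depth `M`, with `M` as large as the girth condition permits, message paths that leave a
variable node along different edges do not meet. -/
theorem LDPCCode.LargeGirth.not_messagePath (hg : 𝒞.LargeGirth) (hdv : 4 ≤ dv) (hdc : dv ≤ dc)
    {M : ℕ} (hM : (M : ℝ) ≤ Real.log N / (2 * Real.log (((dv : ℝ) - 1) * ((dc : ℝ) - 1))))
    {r r' : ℕ} (hr : Odd r) (hr' : r' ≤ 2 * M) {v : Fin N} {a b : Fin dv} {f : Edge N dv}
    (ha : 𝒞.MessagePath r (v, a) r' f) (hab : a ≠ b) : ¬ 𝒞.MessagePath r (v, b) r' f := by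
  intro hb
  obtain ⟨u, c, hc, hlen⟩ := ha.exists_isCycle hr hb hab
  have h1 := hg u c hc
  have h2 := girthConst_le_one hdv hdc
  have h3 : c.length + 2 ≤ 4 * M := by
    have := hr.pos
    omega
  have h3' : (c.length : ℝ) + 2 ≤ 4 * M := by exact_mod_cast h3
  have h4 : 2 * Real.log N / Real.log (((dv : ℝ) - 1) * ((dc : ℝ) - 1)) =
      4 * (Real.log N / (2 * Real.log (((dv : ℝ) - 1) * ((dc : ℝ) - 1)))) := by
    rw [← div_div]; ring
  linarith

end Tanner

/-! ### The tree -/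

section Tree

variable {L dT : ℕ}

theorem TNode.pos_injective : Function.Injective (TNode.pos : TNode L dT → ℕ) := by
  rintro (i | l) (j | m) h <;> simp only [TNode.pos] at h
  · rw [Fin.ext h]
  · have := i.2; omega
  · have := j.2; omega
  · rw [Fin.ext (Nat.add_left_cancel h)]

theorem mem_children {i : Fin (numInner L dT)} {ν : TNode L dT} :
    ν ∈ children i ↔ dT * i.1 < ν.pos ∧ ν.pos ≤ dT * i.1 + dT := by
  simp [children]

theorem card_children_le (i : Fin (numInner L dT)) : (children i).card ≤ dT := by
  have h : (children i).card ≤ (Finset.Ioc (dT * i.1) (dT * i.1 + dT)).card :=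
    Finset.card_le_card_of_injOn TNode.pos (fun ν hν => by
      simpa using mem_children.1 hν) TNode.pos_injective.injOn
  simpa using h

/-- The sum of the leaf data `u` below a node of the tree. -/
noncomputable def nodeWord {V : Type*} [AddCommMonoid V] (hT : 2 ≤ dT) (u : Fin L → V) :
    TNode L dT → V
  | .inr l => u l
  | .inl i => ∑ ν ∈ (children i).attach, nodeWord hT u ν.1
termination_by ν => numInner L dT - ν.pos
decreasing_by
  have h := mem_children.1 ν.2
  have hi := i.2
  simp only [TNode.pos] at h ⊢
  have : i.1 ≤ dT * i.1 := Nat.le_mul_of_pos_left _ (by omega)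
  omega

theorem nodeWord_leaf {V : Type*} [AddCommMonoid V] (hT : 2 ≤ dT) (u : Fin L → V) (l : Fin L) :
    nodeWord hT u (.inr l) = u l := by
  rw [nodeWord]

theorem nodeWord_inner {V : Type*} [AddCommMonoid V] (hT : 2 ≤ dT) (u : Fin L → V)
    (i : Fin (numInner L dT)) :
    nodeWord hT u (.inl i) = ∑ ν ∈ children i, nodeWord hT u ν := by
  rw [nodeWord, Finset.sum_attach]

/-- If the nodes at positions below `n` are expanded, the current leaves are those at the positions
from `n` to `dT * n`, and the sum of their words is the word of the root. -/
theorem nodeWord_root_eq_frontier {V : Type*} [AddCommMonoid V] (hL : 2 ≤ L) (hT : 2 ≤ dT)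
    (u : Fin L → V) (n : ℕ) (hn : n ≤ numInner L dT) :
    nodeWord hT u (.inl ⟨0, numInner_pos hL hT⟩) =
      ∑ ν : TNode L dT with n ≤ ν.pos ∧ ν.pos ≤ dT * n, nodeWord hT u ν := by
  classical
  induction n with
  | zero =>
    have h : (Finset.univ.filter fun ν : TNode L dT => 0 ≤ ν.pos ∧ ν.pos ≤ dT * 0) =
        {.inl ⟨0, numInner_pos hL hT⟩} := by
      ext ν
      rw [Finset.mem_filter, Finset.mem_singleton, ← TNode.pos_injective.eq_iff]
      simp [TNode.pos]
    rw [h, Finset.sum_singleton]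
  | succ n ih =>
    rw [ih (by omega)]
    have hn2 : n ≤ dT * n := Nat.le_mul_of_pos_left _ (by omega)
    have hn3 : dT * (n + 1) = dT * n + dT := by ring
    have h1 : (Finset.univ.filter fun ν : TNode L dT => n ≤ ν.pos ∧ ν.pos ≤ dT * n) =
        insert (.inl ⟨n, hn⟩)
          (Finset.univ.filter fun ν : TNode L dT => n + 1 ≤ ν.pos ∧ ν.pos ≤ dT * n) := by
      ext ν
      rw [Finset.mem_insert, ← TNode.pos_injective.eq_iff]
      simp only [Finset.mem_filter, Finset.mem_univ, true_and, TNode.pos.eq_1]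
      omega
    have h2 : (Finset.univ.filter fun ν : TNode L dT => n + 1 ≤ ν.pos ∧ ν.pos ≤ dT * (n + 1)) =
        children ⟨n, hn⟩ ∪
          (Finset.univ.filter fun ν : TNode L dT => n + 1 ≤ ν.pos ∧ ν.pos ≤ dT * n) := by
      ext ν
      rw [Finset.mem_union, mem_children]
      simp only [Finset.mem_filter, Finset.mem_univ, true_and]
      omega
    rw [h1, h2, Finset.sum_insert (by simp [TNode.pos]), nodeWord_inner, Finset.sum_union]
    rw [Finset.disjoint_left]
    intro ν hν
    have := (mem_children.1 hν).1
    simp only [Finset.mem_filter, Finset.mem_univ, true_and]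
    simp only at this
    omega

theorem leaf_pos_le (hT : 2 ≤ dT) (l : Fin L) :
    numInner L dT + l.1 ≤ dT * numInner L dT := by
  have h : L - 1 ≤ (dT - 1) * numInner L dT := (numInner_le_iff hT).1 le_rfl
  obtain ⟨t, rfl⟩ : ∃ t, dT = t + 1 := ⟨dT - 1, by omega⟩
  rw [Nat.add_sub_cancel] at h
  have := l.2
  rw [Nat.succ_mul]
  omega

theorem nodeWord_root {V : Type*} [AddCommMonoid V] (hL : 2 ≤ L) (hT : 2 ≤ dT) (u : Fin L → V) :
    nodeWord hT u (.inl ⟨0, numInner_pos hL hT⟩) = ∑ l, u l := by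
  rw [nodeWord_root_eq_frontier hL hT u _ le_rfl, Finset.sum_filter, Fintype.sum_sum_type]
  have h1 : ∀ i : Fin (numInner L dT), ¬ (numInner L dT ≤ TNode.pos (.inl i : TNode L dT) ∧
      TNode.pos (.inl i : TNode L dT) ≤ dT * numInner L dT) := fun i h => by
    have h := h.1
    have := i.2
    simp only [TNode.pos] at h
    omega
  have h2 : ∀ l : Fin L, (numInner L dT ≤ TNode.pos (.inr l : TNode L dT) ∧
      TNode.pos (.inr l : TNode L dT) ≤ dT * numInner L dT) := fun l =>
    ⟨Nat.le_add_right _ _, leaf_pos_le hT l⟩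
  simp only [h1, h2, if_false, Finset.sum_const_zero, zero_add, and_self, if_true, nodeWord_leaf]

/-- The depth of the position `n` in the tree; the parent of the position `n + 1` is `n / dT`. -/
def depth (dT : ℕ) : ℕ → ℕ
  | 0 => 0
  | n + 1 => depth dT (n / dT) + 1
termination_by n => n
decreasing_by exact Nat.lt_succ_of_le (Nat.div_le_self _ _)

theorem depth_child {i : Fin (numInner L dT)} {ν : TNode L dT} (h : ν ∈ children i) :
    depth dT ν.pos = depth dT i.1 + 1 := by
  obtain ⟨h1, h2⟩ := mem_children.1 h
  obtain ⟨m, hm⟩ : ∃ m, ν.pos = m + 1 := ⟨ν.pos - 1, by omega⟩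
  rw [hm, depth]
  have : m / dT = i.1 := by
    rw [Nat.div_eq_iff (by omega)]
    rw [mul_comm i.1]
    omega
  rw [this]

theorem pow_depth_le (hT : 2 ≤ dT) (n : ℕ) : dT ^ depth dT n ≤ (dT - 1) * n + 1 := by
  induction n using Nat.strong_induction_on with
  | _ n ih =>
    cases n with
    | zero => simp [depth]
    | succ n =>
      rw [depth, pow_succ]
      have h1 := ih (n / dT) (Nat.lt_succ_of_le (Nat.div_le_self _ _))
      have h2 : n / dT * dT ≤ n := Nat.div_mul_le_self n dT
      obtain ⟨t, rfl⟩ : ∃ t, dT = t + 1 := ⟨dT - 1, by omega⟩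
      rw [Nat.add_sub_cancel] at h1 ⊢
      calc _ ≤ (t * (n / (t + 1)) + 1) * (t + 1) := Nat.mul_le_mul_right _ h1
        _ = t * (n / (t + 1) * (t + 1)) + (t + 1) := by ring
        _ ≤ t * n + (t + 1) := by gcongr
        _ = _ := by ring

theorem depth_inner_lt (hL : 2 ≤ L) (hT : 2 ≤ dT) {M : ℕ}
    (hM : Real.log L / Real.log dT ≤ M) {n : ℕ} (hn : n < numInner L dT) : depth dT n < M := by
  have h1 := pow_depth_le hT n
  have h2 : ¬ L - 1 ≤ (dT - 1) * n := fun h => absurd ((numInner_le_iff hT).2 h) (by omega)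
  have h3 : dT ^ depth dT n < L := by omega
  have hlog : 0 < Real.log dT := Real.log_pos (by exact_mod_cast hT)
  have h4 : (depth dT n : ℝ) < Real.log L / Real.log dT := by
    rw [lt_div_iff₀ hlog, ← Real.log_pow]
    exact Real.log_lt_log (by positivity) (by exact_mod_cast h3)
  exact_mod_cast h4.trans_le hM

theorem depth_leaf_le (hL : 2 ≤ L) (hT : 2 ≤ dT) {M : ℕ}
    (hM : Real.log L / Real.log dT ≤ M) (l : Fin L) :
    depth dT (numInner L dT + l.1) ≤ M := by
  have h0 := numInner_pos hL hT
  obtain ⟨m, hm⟩ : ∃ m, numInner L dT + l.1 = m + 1 := ⟨numInner L dT + l.1 - 1, by omega⟩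
  have h1 := leaf_pos_le hT l
  rw [hm, depth]
  refine depth_inner_lt hL hT hM (Nat.div_lt_of_lt_mul ?_)
  omega

end Tree

/-! ### Which gate failures affect a gate of ENCODED-T -/

section Support

variable {L K N dv dc dT : ℕ}

/-- The Tanner graph edge on which a gate operates. -/
def TGate.edge : TGate L N dv dT → Edge N dv
  | .inl (_, e) => e
  | .inr (_, _, e) => e

/-- The number of message passing half-iterations between a gate and the output of the root. Votes
and leaves at depth `t` have rank `2 t`, and a merge has the rank of the results it merges. -/
def TGate.rank : TGate L N dv dT → ℕ
  | .inl (l, _) => 2 * depth dT (numInner L dT + l.1)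
  | .inr (i, .vote, _) => 2 * depth dT i.1
  | .inr (i, .check, _) => 2 * depth dT i.1 + 1
  | .inr (i, .merge, _) => 2 * depth dT i.1 + 2

/-- The gates joined to the gate `g` by a message path; they include all gates on which the output
of `g` depends. Positions in the tree are only recorded through the rank. -/
def LDPCCode.gateSupport (𝒞 : LDPCCode N K dv dc) (g : TGate L N dv dT) : Set (TGate L N dv dT) :=
  {g' | 𝒞.MessagePath g.rank g.edge g'.rank g'.edge}

theorem TGate.rank_le (hL : 2 ≤ L) (hT : 2 ≤ dT) {M : ℕ} (hM : Real.log L / Real.log dT ≤ M)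
    (g : TGate L N dv dT) : g.rank ≤ 2 * M := by
  rcases g with ⟨l, e⟩ | ⟨i, _ | _ | _, e⟩
  · have := depth_leaf_le hL hT hM l
    simp only [rank]; omega
  all_goals
    have := depth_inner_lt hL hT hM i.2
    simp only [rank]; omega

theorem rank_nodeGate (ν : TNode L dT) (e : Edge N dv) :
    TGate.rank (nodeGate ν e) = 2 * depth dT ν.pos := by
  rcases ν with i | l <;> rfl

theorem edge_nodeGate (ν : TNode L dT) (e : Edge N dv) :
    TGate.edge (nodeGate ν e) = e := by
  rcases ν with i | l <;> rfl

theorem gateSupport_subset (hL : 2 ≤ L) (hT : 2 ≤ dT) (𝒞 : LDPCCode N K dv dc)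
    (A : Matrix (Fin L) (Fin K) (ZMod 2)) (g g' : TGate L N dv dT)
    (h : Wire.gate g' ∈ (encodedT hL hT 𝒞 A).ins g) :
    𝒞.gateSupport g' ⊆ 𝒞.gateSupport g := by
  intro f hf
  change 𝒞.MessagePath _ _ _ _ at hf ⊢
  rcases g with ⟨l, e⟩ | ⟨i, _ | _ | _, e⟩
  · change Wire.gate g' ∈ ({.input l, .const ((A * 𝒞.G) l e.1)} : Multiset (Wire L _)) at h
    simp at h
  · change Wire.gate g' ∈ (children i).val.map fun ν => Wire.gate (nodeGate ν e) at h
    simp only [Multiset.mem_map, Finset.mem_val, Wire.gate.injEq] at h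
    obtain ⟨ν, hν, rfl⟩ := h
    rw [rank_nodeGate, edge_nodeGate, depth_child hν] at hf
    exact hf
  · change Wire.gate g' ∈ (Finset.univ.filter fun e' => 𝒞.chk e' = 𝒞.chk e ∧ e' ≠ e).val.map
      fun e' => Wire.gate (.inr (i, .merge, e')) at h
    simp only [Multiset.mem_map, Finset.mem_val, Wire.gate.injEq, Finset.mem_filter,
      Finset.mem_univ, true_and] at h
    obtain ⟨e', ⟨he1, he2⟩, rfl⟩ := h
    refine .step ?_ he2 hf
    simp [LDPCCode.turn, TGate.rank, TGate.edge, he1]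
  · change Wire.gate g' ∈ (Finset.univ.filter fun a => a ≠ e.2).val.map
      fun a => Wire.gate (.inr (i, .check, (e.1, a))) at h
    simp only [Multiset.mem_map, Finset.mem_val, Wire.gate.injEq, Finset.mem_filter,
      Finset.mem_univ, true_and] at h
    obtain ⟨a, ha, rfl⟩ := h
    refine .step ?_ (fun he => ha (congrArg Prod.snd he)) hf
    simp [LDPCCode.turn, TGate.rank, TGate.edge]

theorem encodedT_dependsOn (hL : 2 ≤ L) (hT : 2 ≤ dT) (𝒞 : LDPCCode N K dv dc)
    (A : Matrix (Fin L) (Fin K) (ZMod 2)) (s : Fin L → ZMod 2) (coin : TGate L N dv dT → ZMod 2)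
    (g : TGate L N dv dT) :
    DependsOn (fun z => (encodedT hL hT 𝒞 A).eval s z coin g) (𝒞.gateSupport g) :=
  (encodedT hL hT 𝒞 A).dependsOn_eval s coin 𝒞.gateSupport (fun _ => .refl _ _)
    (gateSupport_subset hL hT 𝒞 A) g

/-- The messages that arrive at a variable node along different edges depend on different gates. -/
theorem disjoint_gateSupport (hL : 2 ≤ L) (hT : 2 ≤ dT) (hdv : 4 ≤ dv) (hdc : dv ≤ dc)
    {𝒞 : LDPCCode N K dv dc} (hg : 𝒞.LargeGirth) {M : ℕ} (hM : Real.log L / Real.log dT ≤ M)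
    (hM' : (M : ℝ) ≤ Real.log N / (2 * Real.log (((dv : ℝ) - 1) * ((dc : ℝ) - 1))))
    (i : Fin (numInner L dT)) (v : Fin N) {a b : Fin dv} (hab : a ≠ b) :
    Disjoint (𝒞.gateSupport (.inr (i, .check, (v, a)) : TGate L N dv dT))
      (𝒞.gateSupport (.inr (i, .check, (v, b)))) := by
  rw [Set.disjoint_left]
  intro f ha hb
  exact hg.not_messagePath hdv hdc hM' ⟨depth dT i.1, rfl⟩ (f.rank_le hL hT hM) ha hab hb

end Support

/-! ### Error propagation in ENCODED-T -/

theorem gateFn_maj_eq {κ : Type*} (T : Finset κ) (f : κ → ZMod 2) (coin b : ZMod 2)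
    (h : 2 * (T.filter fun a => f a ≠ b).card < T.card) :
    gateFn .maj coin (T.val.map f) = b := by
  have hcount : ∀ c, (T.val.map f).count c = (T.filter fun a => f a = c).card := fun c => by
    rw [Multiset.count_map, Finset.card_def, Finset.filter_val]
    simp only [eq_comm]
  have hsplit := Finset.card_filter_add_card_filter_not (s := T) (fun a => f a = b)
  have hb : ∀ b : ZMod 2, b = 0 ∨ b = 1 := by decide
  rcases hb b with rfl | rfl
  · have h1 : (T.filter fun a => f a = 1) = T.filter fun a => ¬ f a = 0 := by
      have : ∀ c : ZMod 2, c = 1 ↔ ¬ c = 0 := by decide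
      simp only [this]
    simp only [gateFn, hcount, Multiset.card_map, Finset.card_val]
    rw [h1, if_neg (by simp only [ne_eq] at h; omega), if_pos (by simp only [ne_eq] at h; omega)]
  · simp only [gateFn, hcount, Multiset.card_map, Finset.card_val]
    rw [if_pos (by simp only [ne_eq] at h; omega)]

section Errors

variable {L K N dv dc dT : ℕ} (hL : 2 ≤ L) (hT : 2 ≤ dT) (𝒞 : LDPCCode N K dv dc)
  (A : Matrix (Fin L) (Fin K) (ZMod 2)) (s : Fin L → ZMod 2) (z coin : TGate L N dv dT → ZMod 2)

theorem encodedT_eval_leaf (l : Fin L) (e : Edge N dv) :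
    (encodedT hL hT 𝒞 A).eval s z coin (.inl (l, e)) =
      s l * (A * 𝒞.G) l e.1 + z (.inl (l, e)) := by
  refine ((encodedT hL hT 𝒞 A).eval_eq s z coin (.inl (l, e))).trans ?_
  congr 1
  exact prod_map_pair _ _ _

theorem encodedT_eval_merge (i : Fin (numInner L dT)) (e : Edge N dv) :
    (encodedT hL hT 𝒞 A).eval s z coin (.inr (i, .merge, e)) =
      ∑ ν ∈ children i, (encodedT hL hT 𝒞 A).eval s z coin (nodeGate ν e) +
        z (.inr (i, .merge, e)) := by
  refine ((encodedT hL hT 𝒞 A).eval_eq s z coin (.inr (i, .merge, e))).trans ?_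
  congr 1
  exact congrArg Multiset.sum (Multiset.map_map
    (NoisyCircuit.wireVal s ((encodedT hL hT 𝒞 A).eval s z coin))
    (fun ν => Wire.gate (nodeGate ν e)) (children i).val)

/-- The other edges at the parity check node of the edge `e`. -/
def LDPCCode.checkNeighbors (𝒞 : LDPCCode N K dv dc) (e : Edge N dv) : Finset (Edge N dv) :=
  Finset.univ.filter fun e' => 𝒞.chk e' = 𝒞.chk e ∧ e' ≠ e

theorem encodedT_eval_check (i : Fin (numInner L dT)) (e : Edge N dv) :
    (encodedT hL hT 𝒞 A).eval s z coin (.inr (i, .check, e)) =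
      ∑ e' ∈ 𝒞.checkNeighbors e, (encodedT hL hT 𝒞 A).eval s z coin (.inr (i, .merge, e')) +
        z (.inr (i, .check, e)) := by
  refine ((encodedT hL hT 𝒞 A).eval_eq s z coin (.inr (i, .check, e))).trans ?_
  congr 1
  exact congrArg Multiset.sum (Multiset.map_map _ _ _)

theorem encodedT_eval_vote (i : Fin (numInner L dT)) (e : Edge N dv) :
    (encodedT hL hT 𝒞 A).eval s z coin (.inr (i, .vote, e)) =
      gateFn .maj (coin (.inr (i, .vote, e)))
        ((Finset.univ.filter fun a => a ≠ e.2).val.map fun a =>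
          (encodedT hL hT 𝒞 A).eval s z coin (.inr (i, .check, (e.1, a)))) +
        z (.inr (i, .vote, e)) := by
  refine ((encodedT hL hT 𝒞 A).eval_eq s z coin (.inr (i, .vote, e))).trans ?_
  congr 1
  exact congrArg (gateFn .maj _) (Multiset.map_map
    (NoisyCircuit.wireVal s ((encodedT hL hT 𝒞 A).eval s z coin))
    (fun a => Wire.gate (.inr (i, .check, (e.1, a)))) (Finset.univ.filter fun a => a ≠ e.2).val)

/-- The codeword that the tree node `ν` computes in the absence of failures. -/
noncomputable def treeWord (ν : TNode L dT) : Fin N → ZMod 2 :=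
  nodeWord hT (fun l v => s l * (A * 𝒞.G) l v) ν

/-- The bit that a gate of ENCODED-T computes in the absence of failures. -/
noncomputable def idealBit : TGate L N dv dT → ZMod 2
  | .inl (l, e) => treeWord hT 𝒞 A s (.inr l) e.1
  | .inr (i, _, e) => treeWord hT 𝒞 A s (.inl i) e.1

theorem idealBit_nodeGate (ν : TNode L dT) (e : Edge N dv) :
    idealBit hT 𝒞 A s (nodeGate ν e) = treeWord hT 𝒞 A s ν e.1 := by
  rcases ν with i | l <;> rfl

/-- The failure patterns for which the output of a gate is wrong. -/
def errorEvent (g : TGate L N dv dT) : Set (TGate L N dv dT → ZMod 2) :=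
  {z | (encodedT hL hT 𝒞 A).eval s z coin g ≠ idealBit hT 𝒞 A s g}

theorem sum_checkNeighbors (ν : TNode L dT) (e : Edge N dv) :
    ∑ e' ∈ 𝒞.checkNeighbors e, treeWord hT 𝒞 A s ν e'.1 = treeWord hT 𝒞 A s ν e.1 := by
  have hcode : ∀ c, ∑ e' ∈ Finset.univ.filter (fun e' => 𝒞.chk e' = c),
      treeWord hT 𝒞 A s ν e'.1 = 0 := by
    rw [𝒞.code]
    -- The code is a submodule that contains the words of the leaves.
    have hmem : ∀ ν : TNode L dT, treeWord hT 𝒞 A s ν ∈ LinearMap.range 𝒞.G.vecMulLinear := by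
      intro ν
      induction hn : numInner L dT - ν.pos using Nat.strong_induction_on generalizing ν with
      | _ n ih =>
        subst hn
        rcases ν with i | l
        · rw [treeWord, nodeWord_inner]
          refine Submodule.sum_mem _ fun ν hν => ih _ ?_ ν rfl
          have h1 := (mem_children.1 hν).1
          have h2 := i.2
          have h3 : i.1 ≤ dT * i.1 := Nat.le_mul_of_pos_left _ (by omega)
          simp only [TNode.pos.eq_1]
          omega
        · rw [treeWord, nodeWord_leaf]
          refine ⟨fun k => s l * A l k, ?_⟩
          ext v
          simp [Matrix.vecMul, dotProduct, Matrix.mul_apply, Finset.mul_sum, mul_assoc]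
    obtain ⟨r, hr⟩ := hmem ν
    exact ⟨r, hr.symm⟩
  have h : (Finset.univ.filter fun e' => 𝒞.chk e' = 𝒞.chk e) =
      insert e (𝒞.checkNeighbors e) := by
    ext e'
    by_cases he : e' = e <;> simp [LDPCCode.checkNeighbors, he]
  have h2 := hcode (𝒞.chk e)
  rw [h, Finset.sum_insert (by simp [LDPCCode.checkNeighbors])] at h2
  exact (CharTwo.add_eq_zero.1 h2).symm

theorem card_checkNeighbors (e : Edge N dv) : (𝒞.checkNeighbors e).card = dc - 1 := by
  have h : 𝒞.checkNeighbors e = (Finset.univ.filter fun e' => 𝒞.chk e' = 𝒞.chk e).erase e := by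
    ext e'
    simp [LDPCCode.checkNeighbors, and_comm]
  rw [h, Finset.card_erase_of_mem (by simp), 𝒞.chk_deg]

theorem zmod_two_eq_zero_of_ne_one {b : ZMod 2} (h : b ≠ 1) : b = 0 := by
  revert b; decide

theorem errorEvent_leaf_subset (l : Fin L) (e : Edge N dv) :
    errorEvent hL hT 𝒞 A s coin (.inl (l, e)) ⊆ {z | z (.inl (l, e)) = 1} := by
  intro z hz
  by_contra h
  refine hz ?_
  rw [encodedT_eval_leaf, zmod_two_eq_zero_of_ne_one h, add_zero, idealBit, treeWord,
    nodeWord_leaf]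

theorem errorEvent_merge_subset (i : Fin (numInner L dT)) (e : Edge N dv) :
    errorEvent hL hT 𝒞 A s coin (.inr (i, .merge, e)) ⊆
      {z | z (.inr (i, .merge, e)) = 1} ∪
        ⋃ ν ∈ children i, errorEvent hL hT 𝒞 A s coin (nodeGate ν e) := by
  intro z hz
  by_contra h
  simp only [Set.mem_union, Set.mem_iUnion, not_or, not_exists, Set.mem_ofPred_eq] at h
  refine hz ?_
  rw [encodedT_eval_merge, zmod_two_eq_zero_of_ne_one h.1, add_zero, idealBit, treeWord,
    nodeWord_inner, Finset.sum_apply]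
  refine Finset.sum_congr rfl fun ν hν => ?_
  rw [not_not.1 (h.2 ν hν), idealBit_nodeGate, treeWord]

theorem errorEvent_check_subset (i : Fin (numInner L dT)) (e : Edge N dv) :
    errorEvent hL hT 𝒞 A s coin (.inr (i, .check, e)) ⊆
      {z | z (.inr (i, .check, e)) = 1} ∪
        ⋃ e' ∈ 𝒞.checkNeighbors e, errorEvent hL hT 𝒞 A s coin (.inr (i, .merge, e')) := by
  intro z hz
  by_contra h
  simp only [Set.mem_union, Set.mem_iUnion, not_or, not_exists, Set.mem_ofPred_eq] at h
  refine hz ?_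
  rw [encodedT_eval_check, zmod_two_eq_zero_of_ne_one h.1, add_zero, idealBit,
    ← sum_checkNeighbors]
  refine Finset.sum_congr rfl fun e' he' => ?_
  rw [not_not.1 (h.2 e' he'), idealBit]

/-- A vote is wrong only if its gate fails or at least half of the `dv - 1` messages are wrong; in
the case of a tie the coin does not matter for this bound. -/
theorem errorEvent_vote_subset (i : Fin (numInner L dT)) (e : Edge N dv) :
    errorEvent hL hT 𝒞 A s coin (.inr (i, .vote, e)) ⊆
      {z | z (.inr (i, .vote, e)) = 1} ∪
        ⋃ T ∈ (Finset.univ.filter fun a => a ≠ e.2).powersetCard ((dv - 1) ⌈/⌉ 2),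
          ⋂ a ∈ T, errorEvent hL hT 𝒞 A s coin (.inr (i, .check, (e.1, a))) := by
  intro z hz
  by_contra h
  rw [Set.mem_union, not_or] at h
  refine hz ?_
  rw [encodedT_eval_vote, zmod_two_eq_zero_of_ne_one h.1, add_zero]
  refine gateFn_maj_eq _ _ _ _ (lt_of_not_ge fun hge => h.2 ?_)
  set U := Finset.univ.filter fun a => a ≠ e.2
  have hU : U.card = dv - 1 := by
    simp only [U, Finset.filter_ne', Finset.card_erase_of_mem (Finset.mem_univ _),
      Finset.card_univ, Fintype.card_fin]
  rw [hU, ← ceilDiv_le_iff_le_mul (by norm_num)] at hge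
  obtain ⟨T, hTsub, hTcard⟩ := Finset.exists_subset_card_eq hge
  simp only [Set.mem_iUnion, Set.mem_iInter, exists_prop]
  refine ⟨T, Finset.mem_powersetCard.2 ⟨hTsub.trans (Finset.filter_subset _ _), hTcard⟩,
    fun a ha => ?_⟩
  exact (Finset.mem_filter.1 (hTsub ha)).2

end Errors

/-! ### The threshold -/

section Threshold

variable {dv dc dT : ℕ}

theorem two_le_half (hdv : 4 ≤ dv) : 2 ≤ (dv - 1) ⌈/⌉ 2 := by
  rw [Nat.ceilDiv_eq_add_pred_div]; omega

theorem pThr_pos (hdv : 4 ≤ dv) (hdc : dv ≤ dc) (hT : 2 ≤ dT) : 0 < pThr dv dc dT := by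
  have h1 : (0 : ℝ) < ((dv - 1).choose ((dv - 1) / 2) : ℕ) := by
    exact_mod_cast Nat.choose_pos (Nat.div_le_self _ _)
  have h2 : (0 : ℝ) < dc := by exact_mod_cast (by omega : 0 < dc)
  have h3 : (0 : ℝ) < dT := by exact_mod_cast (by omega : 0 < dT)
  unfold pThr
  positivity

/-- The equation that defines the threshold: with message error probability
`dc * (dT + 1) * pThr`, the union bound for the wrong majority is `pThr / dT`. -/
theorem pThr_pow (hdv : 4 ≤ dv) (hdc : dv ≤ dc) (hT : 2 ≤ dT) :
    pThr dv dc dT ^ ((dv - 1) ⌈/⌉ 2 - 1) * (((dv - 1).choose ((dv - 1) ⌈/⌉ 2) : ℕ) *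
      ((dc : ℝ) * (dT + 1)) ^ ((dv - 1) ⌈/⌉ 2) * dT) = 1 := by
  have hd := two_le_half hdv
  have hB : (dv - 1).choose ((dv - 1) / 2) = (dv - 1).choose ((dv - 1) ⌈/⌉ 2) := by
    rw [← Nat.choose_symm (Nat.div_le_self _ _)]
    congr 1
    rw [Nat.ceilDiv_eq_add_pred_div]; omega
  have h1 : (0 : ℝ) < ((dv - 1).choose ((dv - 1) ⌈/⌉ 2) : ℕ) := by
    rw [← hB]
    exact_mod_cast Nat.choose_pos (Nat.div_le_self _ _)
  have h2 : (0 : ℝ) < dc := by exact_mod_cast (by omega : 0 < dc)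
  have h3 : (0 : ℝ) < dT := by exact_mod_cast (by omega : 0 < dT)
  simp only [pThr, hB]
  generalize (((dv - 1).choose ((dv - 1) ⌈/⌉ 2) : ℕ) : ℝ) = B at h1
  generalize (dv - 1) ⌈/⌉ 2 = d at hd
  have hd1 : ((d - 1 : ℕ) : ℝ) = (d : ℝ) - 1 := by rw [Nat.cast_sub (by omega)]; simp
  have hd0 : (d : ℝ) - 1 ≠ 0 := by
    rw [← hd1]; exact_mod_cast (by omega : d - 1 ≠ 0)
  have e1 : ∀ x : ℝ, 0 < x → (x ^ (-1 / ((d : ℝ) - 1))) ^ (d - 1) = x⁻¹ := fun x hx => by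
    rw [← Real.rpow_natCast, ← Real.rpow_mul hx.le, hd1, div_mul_cancel₀ _ hd0, Real.rpow_neg_one]
  have e2 : ∀ x : ℝ, 0 < x → (x ^ (-(d : ℝ) / ((d : ℝ) - 1))) ^ (d - 1) = (x ^ d)⁻¹ :=
    fun x hx => by
    rw [← Real.rpow_natCast, ← Real.rpow_mul hx.le, hd1, div_mul_cancel₀ _ hd0,
      Real.rpow_neg hx.le, Real.rpow_natCast]
  rw [mul_pow, mul_pow, mul_pow, e1 _ h1, e1 _ h3, e2 _ h2, e2 _ (by positivity), mul_pow]
  field_simp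

theorem pThr_lt_half (hdv : 4 ≤ dv) (hdc : dv ≤ dc) (hT : 2 ≤ dT) : pThr dv dc dT < 1 / 2 := by
  have hd := two_le_half hdv
  by_contra hge
  rw [not_lt] at hge
  have h2 : (4 : ℝ) ≤ (dc : ℝ) * (dT + 1) := by
    have : (4 : ℝ) ≤ dc := by exact_mod_cast hdv.trans hdc
    nlinarith [(Nat.cast_nonneg dT : (0 : ℝ) ≤ dT)]
  have h3 : (2 : ℝ) ≤ dT := by exact_mod_cast hT
  have h1 : (1 : ℝ) ≤ ((dv - 1).choose ((dv - 1) ⌈/⌉ 2) : ℕ) := by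
    have : 0 < (dv - 1).choose ((dv - 1) ⌈/⌉ 2) :=
      Nat.choose_pos (by rw [Nat.ceilDiv_eq_add_pred_div]; omega)
    exact_mod_cast this
  have h := pThr_pow hdv hdc hT
  generalize (((dv - 1).choose ((dv - 1) ⌈/⌉ 2) : ℕ) : ℝ) = B at h1 h
  generalize (dv - 1) ⌈/⌉ 2 = d at hd h
  have h4 : (1 / 2 : ℝ) ^ (d - 1) * (1 * 4 ^ d * 2) ≤ 1 :=
    calc _ ≤ pThr dv dc dT ^ (d - 1) * (B * ((dc : ℝ) * (dT + 1)) ^ d * dT) := by gcongr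
      _ = 1 := h
  have h5 : (1 / 2 : ℝ) ^ (d - 1) * (1 * 4 ^ d * 2) = 4 * 2 ^ d := by
    obtain ⟨n, rfl⟩ : ∃ n, d = n + 1 := ⟨d - 1, by omega⟩
    have : (4 : ℝ) ^ (n + 1) = 2 ^ n * 2 ^ n * 4 := by
      rw [pow_succ, ← mul_pow]; norm_num
    rw [Nat.add_sub_cancel, this, pow_succ]
    have h6 : (1 / 2 : ℝ) ^ n * 2 ^ n = 1 := by rw [← mul_pow]; norm_num
    linear_combination (8 * 2 ^ n) * h6
  have h6 : (1 : ℝ) ≤ 2 ^ d := one_le_pow₀ (by norm_num)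
  linarith

/-- One step of density evolution. The message error probability is `x * (dc * (dT + 1)) * p` with
`x = 1 + (ρ - 1) / dc` and `ρ = dc / (dT + 1)`. If `x ≤ 1`, then `p ≤ pThr` suffices; if `x > 1`,
then `x ^ 2 ≤ ρ`, so `x ^ 2 * p ≤ pThr`, and `x ^ d ≤ (x ^ 2) ^ (d - 1)`. -/
theorem majority_union_bound (hdv : 4 ≤ dv) (hdc : dv ≤ dc) (hT : 2 ≤ dT) {p : ℝ} (hp : 0 < p)
    (h1 : p ≤ pThr dv dc dT) (h2 : p ≤ ((dT : ℝ) + 1) / dc * pThr dv dc dT) :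
    (((dv - 1).choose ((dv - 1) ⌈/⌉ 2) : ℕ) : ℝ) *
      ((((dc : ℝ) - 1) * (dT + 2) + 1) * p) ^ ((dv - 1) ⌈/⌉ 2) ≤ p / dT := by
  have hd := two_le_half hdv
  have hP := pThr_pow hdv hdc hT
  have hP0 := pThr_pos hdv hdc hT
  have hB : (0 : ℝ) ≤ ((dv - 1).choose ((dv - 1) ⌈/⌉ 2) : ℕ) := Nat.cast_nonneg _
  have hdc4 : (4 : ℝ) ≤ dc := by exact_mod_cast hdv.trans hdc
  have hT2 : (2 : ℝ) ≤ dT := by exact_mod_cast hT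
  generalize (((dv - 1).choose ((dv - 1) ⌈/⌉ 2) : ℕ) : ℝ) = B at hP hB ⊢
  generalize (dv - 1) ⌈/⌉ 2 = d at hd hP ⊢
  generalize pThr dv dc dT = P at h1 h2 hP hP0
  obtain ⟨n, rfl⟩ : ∃ n, d = n + 1 := ⟨d - 1, by omega⟩
  rw [Nat.add_sub_cancel] at hP
  set ρ : ℝ := dc / (dT + 1) with hρ
  set x : ℝ := 1 + (ρ - 1) / dc with hx
  have hρ0 : 0 < ρ := by positivity
  have hρp : ρ * p ≤ P := by
    have := mul_le_mul_of_nonneg_left h2 hρ0.le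
    rwa [hρ, ← mul_assoc, div_mul_div_cancel₀ (by positivity), div_self (by positivity),
      one_mul] at this
  have hxq : (((dc : ℝ) - 1) * (dT + 2) + 1) * p = x * (dc * (dT + 1)) * p := by
    rw [hx, hρ]
    field_simp
    ring
  have hx0 : 0 ≤ x := by
    have : -1 ≤ (ρ - 1) / dc := by
      rw [le_div_iff₀ (by positivity)]; linarith
    linarith
  have hkey : x ^ (n + 1) * p ^ n ≤ P ^ n := by
    rcases le_total x 1 with hx1 | hx1
    · calc x ^ (n + 1) * p ^ n ≤ 1 * p ^ n := by
            gcongr; exact pow_le_one₀ hx0 hx1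
        _ ≤ P ^ n := by rw [one_mul]; gcongr
    · have hρ1 : 0 ≤ ρ - 1 := by
        have h : 0 ≤ (ρ - 1) / dc := by linarith
        rwa [le_div_iff₀ (by positivity), zero_mul] at h
      have hρdc : ρ ≤ dc := div_le_self (by positivity) (by linarith)
      set t := (ρ - 1) / dc with ht
      have ht0 : 0 ≤ t := by positivity
      have ht1 : t ≤ 1 := by rw [ht, div_le_one (by positivity)]; linarith
      have htρ : ρ = 1 + dc * t := by rw [ht]; field_simp; ring
      have hsq : x ^ 2 ≤ ρ := by rw [htρ, hx]; nlinarith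
      calc x ^ (n + 1) * p ^ n ≤ x ^ (2 * n) * p ^ n := by
            gcongr
            omega
        _ = (x ^ 2 * p) ^ n := by rw [pow_mul, mul_pow]
        _ ≤ P ^ n := by
            gcongr
            exact (mul_le_mul_of_nonneg_right hsq hp.le).trans hρp
  rw [hxq, le_div_iff₀ (by positivity)]
  calc B * (x * (dc * (dT + 1)) * p) ^ (n + 1) * dT =
        x ^ (n + 1) * p ^ n * (B * (dc * (dT + 1)) ^ (n + 1) * dT) * p := by
        rw [mul_pow, mul_pow]; ring
    _ ≤ P ^ n * (B * (dc * (dT + 1)) ^ (n + 1) * dT) * p := by gcongr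
    _ = p := by rw [hP, one_mul]

end Threshold

/-! ### Error probabilities in ENCODED-T -/

section Main

variable {L K N dv dc dT : ℕ}

/-- Every tree node keeps its error probability below `(1 + 1 / dT) * p₀`: merging multiplies it by
at most `dT`, and one decoding iteration on independent messages brings it down again. -/
theorem pr_errorEvent_nodeGate_le (hL : 2 ≤ L) (hT : 2 ≤ dT) (hdv : 4 ≤ dv) (hdc : dv ≤ dc)
    {𝒞 : LDPCCode N K dv dc} (hg : 𝒞.LargeGirth) {M : ℕ} (hM : Real.log L / Real.log dT ≤ M)
    (hM' : (M : ℝ) ≤ Real.log N / (2 * Real.log (((dv : ℝ) - 1) * ((dc : ℝ) - 1))))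
    (A : Matrix (Fin L) (Fin K) (ZMod 2)) {p : GateKind → ℝ} {p₀ : ℝ} (h0 : ∀ k, 0 ≤ p k)
    (hp : ∀ k, p k ≤ p₀) (hp₀ : 0 < p₀) (h1 : p₀ ≤ pThr dv dc dT)
    (h2 : p₀ ≤ ((dT : ℝ) + 1) / dc * pThr dv dc dT)
    (s : Fin L → ZMod 2) (coin : TGate L N dv dT → ZMod 2) (ν : TNode L dT) (e : Edge N dv) :
    pr (fun g : TGate L N dv dT => p ((encodedT hL hT 𝒞 A).kind g))
      (errorEvent hL hT 𝒞 A s coin (nodeGate ν e)) ≤ (1 + 1 / dT) * p₀ := by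
  have hle1 : ∀ k, p k ≤ 1 := fun k =>
    (hp k).trans (h1.trans ((pThr_lt_half hdv hdc hT).le.trans (by norm_num)))
  set q : TGate L N dv dT → ℝ := fun g => p ((encodedT hL hT 𝒞 A).kind g) with hq
  have hq0 : ∀ g, 0 ≤ q g := fun g => h0 _
  have hq1 : ∀ g, q g ≤ 1 := fun g => hle1 _
  have hfail : ∀ g, pr q {z | z g = 1} ≤ p₀ := fun g => (pr_apply_eq_one q g).trans_le (hp _)
  have hT0 : (0 : ℝ) < dT := by exact_mod_cast (by omega : 0 < dT)
  have hdc1 : ((dc - 1 : ℕ) : ℝ) = (dc : ℝ) - 1 := by rw [Nat.cast_sub (by omega)]; simp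
  induction hn : numInner L dT - ν.pos using Nat.strong_induction_on generalizing ν e with
  | _ n ih =>
    subst hn
    rcases ν with i | l
    swap
    · refine (pr_mono hq0 hq1 (errorEvent_leaf_subset hL hT 𝒞 A s coin l e)).trans ?_
      refine (hfail _).trans ?_
      have : 0 ≤ 1 / (dT : ℝ) * p₀ := by positivity
      linarith
    have hchild : ∀ ν ∈ children i, ∀ e,
        pr q (errorEvent hL hT 𝒞 A s coin (nodeGate ν e)) ≤ (1 + 1 / dT) * p₀ := by
      intro ν hν e
      refine ih _ ?_ ν e rfl
      have h1 := (mem_children.1 hν).1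
      have h2 := i.2
      have h3 : i.1 ≤ dT * i.1 := Nat.le_mul_of_pos_left _ (by omega)
      simp only [TNode.pos.eq_1]
      omega
    have hmerge : ∀ e, pr q (errorEvent hL hT 𝒞 A s coin (.inr (i, .merge, e))) ≤
        (dT + 2) * p₀ := by
      intro e
      refine (pr_mono hq0 hq1 (errorEvent_merge_subset hL hT 𝒞 A s coin i e)).trans ?_
      refine (pr_union_le hq0 hq1 _ _).trans ?_
      have h3 := (pr_biUnion_le hq0 hq1 _ _).trans
        (Finset.sum_le_card_nsmul _ _ _ fun ν hν => hchild ν hν e)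
      have h4 : ((children i).card : ℝ) ≤ dT := by exact_mod_cast card_children_le i
      have h5 : ((children i).card : ℝ) * ((1 + 1 / dT) * p₀) ≤ dT * ((1 + 1 / dT) * p₀) := by
        gcongr
      have h6 : (dT : ℝ) * ((1 + 1 / dT) * p₀) = (dT + 1) * p₀ := by field_simp
      rw [nsmul_eq_mul] at h3
      have h7 := hfail (.inr (i, .merge, e))
      linarith
    have hcheck : ∀ e, pr q (errorEvent hL hT 𝒞 A s coin (.inr (i, .check, e))) ≤
        (((dc : ℝ) - 1) * (dT + 2) + 1) * p₀ := by
      intro e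
      refine (pr_mono hq0 hq1 (errorEvent_check_subset hL hT 𝒞 A s coin i e)).trans ?_
      refine (pr_union_le hq0 hq1 _ _).trans ?_
      have h3 := (pr_biUnion_le hq0 hq1 _ _).trans
        (Finset.sum_le_card_nsmul (𝒞.checkNeighbors e) _ _ fun e' _ => hmerge e')
      rw [nsmul_eq_mul, card_checkNeighbors, hdc1] at h3
      have h4 := hfail (.inr (i, .check, e))
      linarith
    refine (pr_mono hq0 hq1 (errorEvent_vote_subset hL hT 𝒞 A s coin i e)).trans ?_
    refine (pr_union_le hq0 hq1 _ _).trans ?_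
    have hT' : ∀ T ∈ (Finset.univ.filter fun a => a ≠ e.2).powersetCard ((dv - 1) ⌈/⌉ 2),
        pr q (⋂ a ∈ T, errorEvent hL hT 𝒞 A s coin (.inr (i, .check, (e.1, a)))) ≤
          ((((dc : ℝ) - 1) * (dT + 2) + 1) * p₀) ^ ((dv - 1) ⌈/⌉ 2) := by
      intro T hTm
      rw [pr_biInter T
        (S := fun a => 𝒞.gateSupport (.inr (i, .check, (e.1, a)) : TGate L N dv dT))]
      · rw [← (Finset.mem_powersetCard.1 hTm).2, ← Finset.prod_const]
        exact Finset.prod_le_prod (fun a _ => pr_nonneg hq0 hq1 _) fun a _ => hcheck _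
      · intro a _ x y hxy
        have h := encodedT_dependsOn hL hT 𝒞 A s coin (.inr (i, .check, (e.1, a))) hxy
        change (_ ≠ _) = (_ ≠ _)
        beta_reduce at h
        rw [h]
      · exact fun a _ b _ hab => disjoint_gateSupport hL hT hdv hdc hg hM hM' i e.1 hab
    have h3 := (pr_biUnion_le hq0 hq1 _ _).trans (Finset.sum_le_card_nsmul _ _ _ hT')
    have hU : (Finset.univ.filter fun a : Fin dv => a ≠ e.2).card = dv - 1 := by
      simp only [Finset.filter_ne', Finset.card_erase_of_mem (Finset.mem_univ _),
        Finset.card_univ, Fintype.card_fin]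
    rw [nsmul_eq_mul, Finset.card_powersetCard, hU] at h3
    have h4 := majority_union_bound hdv hdc hT hp₀ h1 h2
    have h5 := hfail (.inr (i, .vote, e))
    have h6 : (1 + 1 / (dT : ℝ)) * p₀ = p₀ + p₀ / dT := by ring
    rw [h6]
    exact add_le_add h5 (h3.trans h4)

theorem encodedT_bitErrorProb_le (hL : 2 ≤ L) (hK : 0 < K) (hT : 2 ≤ dT) (hdv : 4 ≤ dv)
    (hdc : dv ≤ dc)
    {𝒞 : LDPCCode N K dv dc} (hg : 𝒞.LargeGirth) {M : ℕ} (hM : Real.log L / Real.log dT ≤ M)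
    (hM' : (M : ℝ) ≤ Real.log N / (2 * Real.log (((dv : ℝ) - 1) * ((dc : ℝ) - 1))))
    (A : Matrix (Fin L) (Fin K) (ZMod 2)) {p : GateKind → ℝ} {p₀ : ℝ} (h0 : ∀ k, 0 ≤ p k)
    (hp : ∀ k, p k ≤ p₀) (hp₀ : 0 < p₀) (h1 : p₀ ≤ pThr dv dc dT)
    (h2 : p₀ ≤ ((dT : ℝ) + 1) / dc * pThr dv dc dT) :
    (encodedT hL hT 𝒞 A).bitErrorProb A p ≤ (1 + 1 / dT) * p₀ := by
  have : Nonempty (encodedT hL hT 𝒞 A).Sel := ⟨(⟨0, by omega⟩ : Fin dv)⟩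
  refine NoisyCircuit.bitErrorProb_le _ hK fun k s coin a => ?_
  refine le_trans (le_of_eq ?_) (pr_errorEvent_nodeGate_le hL hT hdv hdc hg hM hM' A h0 hp hp₀ h1
    h2 s coin (.inl ⟨0, numInner_pos hL hT⟩) (Fin.castLE 𝒞.dim_le k, a))
  have hword : Matrix.vecMul s A k = idealBit hT 𝒞 A s
      (nodeGate (.inl ⟨0, numInner_pos hL hT⟩) ((Fin.castLE 𝒞.dim_le k, a) : Edge N dv)) := by
    rw [idealBit_nodeGate, treeWord, nodeWord_root hL, Finset.sum_apply]
    change _ = Matrix.vecMul s (A * 𝒞.G) (Fin.castLE 𝒞.dim_le k)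
    rw [← Matrix.vecMul_vecMul]
    change _ = ∑ k', Matrix.vecMul s A k' * 𝒞.G k' (Fin.castLE 𝒞.dim_le k)
    simp [𝒞.systematic]
  rw [hword]
  rfl

end Main

end NoisyComputing

theorem proposition1 (D : ℕ) (hD : 3 < D) :
    ∃ c C : ℝ, 0 < c ∧ 0 < C ∧
      ∀ ε : GateKind → ℝ → ℝ, (∀ k, IsTradeoff (ε k)) →
      ∀ (L K : ℕ) (hL : 2 ≤ L), 0 < K →
      ∀ (A : Matrix (Fin L) (Fin K) (ZMod 2)) (ptar : ℝ), 0 < ptar →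
        -- the uncoded scheme: lower bound on the energy per output bit
        (2 * ptar / L ∈ ε .and '' Set.Ioi 0 → 2 * ptar / L ∈ ε .xor '' Set.Ioi 0 →
          ∀ Ev : ℝ, 0 < Ev →
            max (ε .and Ev) (ε .xor Ev) < 1 / (2 * (L : ℝ) - 2) →
            (uncoded hL A).bitErrorProb A (fun k => ε k Ev) < ptar →
            c * (L * max (energyInv (ε .and) (2 * ptar / L)) (energyInv (ε .xor) (2 * ptar / L))) ≤
              (uncoded hL A).energyPerBit Ev) ∧
        -- ENCODED-T
        ∀ (N dv dc dT : ℕ) (hT : 2 ≤ dT), dT ≤ D → 4 ≤ dv → dv ≤ dc → dc ≤ D →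
        ∀ 𝒞 : LDPCCode N K dv dc,
          -- upper bound: the target is attained with this energy per output bit
          (𝒞.LargeGirth →
            (⌈Real.log L / Real.log dT⌉ : ℝ) ≤
              Real.log N / (2 * Real.log (((dv : ℝ) - 1) * ((dc : ℝ) - 1))) →
            BelowThreshold dv dc dT (fun _ => ptar / 2) →
            (∀ k, ptar / 2 ∈ ε k '' Set.Ioi 0) →
            ∃ Ev : ℝ, Operating ε Ev ∧
              (encodedT hL hT 𝒞 A).bitErrorProb A (fun k => ε k Ev) < ptar ∧
              (encodedT hL hT 𝒞 A).energyPerBit Ev ≤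
                C * (L * N / K * max (energyInv (ε .maj) (ptar / 2))
                  (max (energyInv (ε .xor) (ptar / 2)) (energyInv (ε .and) (ptar / 2))))) ∧
          -- lower bound: every operating energy that attains the target
          (ptar ∈ ε .maj '' Set.Ioi 0 →
            ∀ Ev : ℝ, Operating ε Ev →
              (encodedT hL hT 𝒞 A).bitErrorProb A (fun k => ε k Ev) < ptar →
              c * (L * N / K * energyInv (ε .maj) ptar) ≤
                (encodedT hL hT 𝒞 A).energyPerBit Ev) := by
  refine ⟨1, 4 * D, one_pos, by positivity, ?_⟩
  intro ε hε L K hL hK A ptar hptar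
  have hL2 : (2 : ℝ) ≤ L := by exact_mod_cast hL
  refine ⟨?_, ?_⟩
  · intro hand hxor Ev hE hmax hlt
    have hb := (uncoded_gate_bound hL hK A (fun k => (hε k).nonneg Ev hE) hmax).trans_lt hlt
    have hm : max (ε .and Ev) (ε .xor Ev) ≤ 2 * ptar / L := by
      rw [le_div_iff₀ (by linarith)]; linarith
    have h1 := ((hε .and).energyInv_le_iff hand hE).2 ((le_max_left _ _).trans hm)
    have h2 := ((hε .xor).energyInv_le_iff hxor hE).2 ((le_max_right _ _).trans hm)
    rw [one_mul]
    exact (mul_le_mul_of_nonneg_left (max_le h1 h2) (by linarith)).trans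
      (uncoded_energy_ge hL hK A hE)
  intro N dv dc dT hT hTD hdv hdc hdcD 𝒞
  refine ⟨?_, ?_⟩
  · intro hg hM hthr hinv
    set Ev := max (energyInv (ε .maj) (ptar / 2))
      (max (energyInv (ε .xor) (ptar / 2)) (energyInv (ε .and) (ptar / 2))) with hEv
    have hE : 0 < Ev := lt_max_of_lt_left (energyInv_pos (hinv .maj))
    have hle : ∀ k, ε k Ev ≤ ptar / 2 := fun k => by
      refine ((hε k).energyInv_le_iff (hinv k) hE).1 ?_
      cases k
      · exact (le_max_right _ _).trans (le_max_right _ _)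
      · exact (le_max_left _ _).trans (le_max_right _ _)
      · exact le_max_left _ _
    obtain ⟨h1, h2, -⟩ := hthr
    have hlog : 0 ≤ Real.log L / Real.log dT :=
      div_nonneg (Real.log_nonneg (by linarith)) (Real.log_natCast_nonneg dT)
    rw [← natCast_ceil_eq_intCast_ceil hlog] at hM
    refine ⟨Ev, ⟨hE, fun k => (hle k).trans_lt (h1.trans_lt (pThr_lt_half hdv hdc hT))⟩, ?_, ?_⟩
    · refine (encodedT_bitErrorProb_le hL hK hT hdv hdc hg (Nat.le_ceil _) hM A
        (fun k => (hε k).nonneg Ev hE) hle (by linarith) h1 h2).trans_lt ?_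
      have hT2 : 1 / (dT : ℝ) ≤ 1 / 2 :=
        one_div_le_one_div_of_le (by norm_num) (by exact_mod_cast hT)
      nlinarith
    · exact encodedT_energy_le hL hT hK (hdc.trans hdcD) 𝒞 A hE
  · intro hinv Ev hop hlt
    have h := (encodedT_maj_le hL hT hdv hK 𝒞 A (fun k => (hε k).nonneg Ev hop.1)
      fun k => (hop.2 k).le).trans_lt hlt
    have h1 := ((hε .maj).energyInv_le_iff hinv hop.1).2 h.le
    rw [one_mul]
    exact (mul_le_mul_of_nonneg_left h1 (by positivity)).trans
      (encodedT_energy_ge hL hT hdv hK 𝒞 A hop.1)
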